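/- Let $m\ge 0$, $N\ge 2$ be integers and let $A$ be a random sampling matrix, i.e. a random $m\times N$ complex matrix whose rows $X_1,\dots,X_m$ are independent random vectors in $\mathbf{C}^N$ with $\|X_j\|_\infty\le K$ almost surely, for some $K\ge 1$, and $\mathbf{E}[X_j^*X_j]=I_N$ for all $j$. For an $m\times N$ complex matrix $B$ and a real number $s\ge 1$, the restricted isometry constant $\delta_s(B)$ is the smallest $\delta$ such that $(1-\delta)\|x\|_2^2\le\|Bx\|_2^2\le(1+\delta)\|x\|_2^2$ for all $x\in\mathbf{C}^N$ with at most $s$ nonzero entries, and the low entropy isometry constant $\tilde\delta_s(B)$ is the smallest $\delta$ such that $\bigl|\|Bx\|_2^2-\|x\|_2^2\bigr|\le\delta\|x\|_2^2$ for all nonzero $x\in\mathbf{C}^N$ with $\|x\|_1^2/\|x\|_2^2\le s$. Let $s\ge 1$, $0<\delta,\epsilon,\lambda<1$, put \[ C_1=\frac{2^{5}\mathrm{e}^{1/4}}{\ln 2}\,\frac{(\sqrt{\mathrm e}+\delta)^{1/2}}{(1-\lambda)\delta},\qquad C_2=\frac{2^6\mathrm{e}^{3/2}(\delta+\sqrt{\mathrm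 e})}{(\delta\lambda)^2}, \] and suppose that \[ \sqrt m>C_1K\sqrt s\left(\ln^{1/2}(2^{3/4}K^2s)\,\ln(C_2K^2s)\,\ln^{1/2}N+\ln^{1/2}(1/\epsilon)\right). \] Then $P\bigl(\tilde\delta_s(\tfrac1{\sqrt m}A)>\delta\bigr)<\epsilon$ and $P\bigl(\delta_s(\tfrac1{\sqrt m}A)>\delta\bigr)<\epsilon$; that is, with probability greater than $1-\epsilon$ the matrix $\tfrac1{\sqrt m}A$ satisfies the low entropy isometry inequality of order $s$ with the number $\delta$, and likewise for the restricted isometry inequalities of order $s$. -/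

import Mathlib

open MeasureTheory ProbabilityTheory

noncomputable section

namespace CompressiveSensing

/-- The `ℓ¹`-norm on `ℂⁿ`. -/
def l1Norm {n : ℕ} (x : Fin n → ℂ) : ℝ := ‖WithLp.toLp 1 x‖

/-- The `ℓ²`-norm on `ℂⁿ`. -/
def l2Norm {n : ℕ} (x : Fin n → ℂ) : ℝ := ‖WithLp.toLp 2 x‖

/-- `x` is `s`-sparse: it has at most `s` nonzero entries. -/
def IsSparse {n : ℕ} (s : ℝ) (x : Fin n → ℂ) : Prop := (hammingNorm x : ℝ) ≤ s

/-- The `ℓ¹`-entropy `‖x‖₁² / ‖x‖₂²` of a (nonzero) vector. -/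
def entropy {n : ℕ} (x : Fin n → ℂ) : ℝ := l1Norm x ^ 2 / l2Norm x ^ 2

/-- The restricted isometry inequalities of order `s` hold for `A` with the number `δ`. -/
def HasRIP {m N : ℕ} (A : Matrix (Fin m) (Fin N) ℂ) (s δ : ℝ) : Prop :=
  ∀ x : Fin N → ℂ, IsSparse s x →
    (1 - δ) * l2Norm x ^ 2 ≤ l2Norm (A.mulVec x) ^ 2 ∧
      l2Norm (A.mulVec x) ^ 2 ≤ (1 + δ) * l2Norm x ^ 2

/-- The low entropy isometry inequality of order `t` holds for `A` with the number `δ`. -/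
def HasLEIP {m N : ℕ} (A : Matrix (Fin m) (Fin N) ℂ) (t δ : ℝ) : Prop :=
  ∀ x : Fin N → ℂ, x ≠ 0 → entropy x ≤ t →
    |l2Norm (A.mulVec x) ^ 2 - l2Norm x ^ 2| ≤ δ * l2Norm x ^ 2

/-- The restricted isometry constant of order `s` of `A`: the smallest admissible `δ`. -/
def ricConst {m N : ℕ} (A : Matrix (Fin m) (Fin N) ℂ) (s : ℝ) : ℝ :=
  sInf {δ : ℝ | HasRIP A s δ}

/-- The low entropy isometry constant of order `t` of `A`: the smallest admissible `δ`. -/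
def leicConst {m N : ℕ} (A : Matrix (Fin m) (Fin N) ℂ) (t : ℝ) : ℝ :=
  sInf {δ : ℝ | HasLEIP A t δ}

/-- A random sampling matrix with bound `K`: the rows `X_j` are independent random vectors in
`ℂ^N` with `‖X_j‖_∞ ≤ K` almost surely (`‖·‖` is the sup norm on `Fin N → ℂ`) and
`E[X_j^* X_j] = I_N`, the expectation of the `N × N` matrix being taken entrywise. -/
structure IsRandomSamplingMatrix {Ω : Type*} [MeasurableSpace Ω] (P : Measure Ω) {m N : ℕ}
    (A : Ω → Matrix (Fin m) (Fin N) ℂ) (K : ℝ) : Prop where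
  measurable_row : ∀ j : Fin m, Measurable (fun ω => (A ω j : Fin N → ℂ))
  indep : iIndepFun (fun (j : Fin m) (ω : Ω) => (A ω j : Fin N → ℂ)) P
  bounded : ∀ j : Fin m, ∀ᵐ ω ∂P, ‖(A ω j : Fin N → ℂ)‖ ≤ K
  isotropic : ∀ (j : Fin m) (k l : Fin N),
    ∫ ω, star (A ω j k) * A ω j l ∂P = (1 : Matrix (Fin N) (Fin N) ℂ) k l

/-- The normalized matrix `m^{-1/2} A`. -/
def normalized {m N : ℕ} (A : Matrix (Fin m) (Fin N) ℂ) : Matrix (Fin m) (Fin N) ℂ :=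
  (1 / √(m : ℝ)) • A

/-- The constant `C₁(δ, lam)`. -/
def C₁ (δ lam : ℝ) : ℝ :=
  2 ^ 5 * Real.exp (1 / 4) / Real.log 2 * (√(√(Real.exp 1) + δ) / ((1 - lam) * δ))

/-- The constant `C₂(δ, lam)`. -/
def C₂ (δ lam : ℝ) : ℝ :=
  2 ^ 6 * Real.exp (3 / 2) * (δ + √(Real.exp 1)) / (δ * lam) ^ 2

end CompressiveSensing

end

/-! Put M = K√s and let Z (`deviation`) be the supremum, over unit vectors x with ‖x‖₁ ≤ √s, of |m⁻¹
∑ⱼ (|Xⱼ·x|² - 1)|. By homogeneity Z ≤ δ gives the low entropy inequality, and Cauchy–Schwarz on the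
support then gives the restricted one. So it suffices to show P(Z > δ) < ε.

Symmetrization (`integral_supAbs_pow_le_two_pow_mul`) replaces the p-th moment of Z by that of a
Rademacher process with the rows frozen, and this process is chained over finite nets
(`exists_rademacher_bound`). The nets come from Maurey's empirical method: a point of the ℓ¹-ball is
close to an average of few vertices, the error being measured in the ℓ^{2q}-norm of Ax. Hölder turns
an ℓ^{2q}-distance into a sub-Gaussian increment at the price of a factor M^{1/q}, which is bounded
for q = 1 + log M². At scale e^{-k} the net has N^{O(q e^{2k})} points, so scale times root of
log-cardinality is the same at every level, and the number of levels enters only as a logarithm.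

The increments also carry a factor √(m(1+Z)), because ∑ⱼ |Xⱼ·x|² ≤ m(1+Z). Hence E Z^p ≤ E
(D√(1+Z))^p (`integral_deviation_pow_le`). If D√(1+η) < η with η = δ/√e, the tangent to the square
root at η forces E Z^p < η^p, and Markov gives P(Z > δ) < e^{-p/2} ≤ ε once p ≥ 2 log(1/ε)
(`measureReal_lt_of_selfBounding`). The hypothesis on m ensures that D is this small; λ divides the
allowance for D between the chain and its truncation error (`exists_chaining_parameters`). -/

noncomputable section

namespace CompressiveSensing

/-! ### Sub-Gaussian moments on finite weighted spaces -/

section FiniteProbability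

variable {α β ι κ : Type*}

/-- Independence of coordinates under product weights: expectations of products factor. -/
lemma sum_prod_mul_prod [Fintype ι] [Fintype κ] [DecidableEq κ] (w : ι → ℝ) (g : κ → ι → ℝ) :
    ∑ f : κ → ι, (∏ j, w (f j)) * ∏ j, g j (f j) = ∏ j, ∑ i, w i * g j i := by
  rw [Finset.prod_univ_sum]
  simp [Fintype.piFinset_univ, Finset.prod_mul_distrib]

lemma sum_prod_weight [Fintype ι] [Fintype κ] [DecidableEq κ] {w : ι → ℝ} (hw : ∑ i, w i = 1) :
    ∑ f : κ → ι, ∏ j : κ, w (f j) = 1 := by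
  simpa [hw] using sum_prod_mul_prod w (fun (_ : κ) (_ : ι) => (1 : ℝ))

/-- The moments of a sub-Gaussian variable on a finite weighted space. -/
lemma sum_mul_abs_rpow_le [Fintype α] {w g : α → ℝ} (hw : ∀ a, 0 ≤ w a) {σ : ℝ} (hσ : 0 < σ)
    (h : ∀ θ : ℝ, ∑ a, w a * Real.exp (θ * g a) ≤ Real.exp (θ ^ 2 * σ ^ 2 / 2))
    {r : ℝ} (hr : 0 < r) :
    ∑ a, w a * |g a| ^ r ≤ 2 * (√r * σ) ^ r * Real.exp (-(r / 2)) := by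
  have hsr : 0 < √r := Real.sqrt_pos.2 hr
  have hrr : √r * √r = r := Real.mul_self_sqrt hr.le
  -- This θ minimises (r/(eθ))^r exp(θ²σ²/2), the bound that results from u ≤ exp(u - 1) with u =
  -- θ|g|/r.
  set θ : ℝ := √r / σ with hθ
  have hθ0 : 0 < θ := by positivity
  have key : ∀ a, |g a| ^ r ≤
      (√r * σ) ^ r * Real.exp (-r) * (Real.exp (θ * g a) + Real.exp (-θ * g a)) := by
    intro a
    have h1 : |g a| ≤ √r * σ * Real.exp (θ * |g a| / r - 1) := by
      have h2 := Real.add_one_le_exp (θ * |g a| / r - 1)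
      have h3 : |g a| = √r * σ * (θ * |g a| / r) := by
        rw [hθ]; field_simp; rw [Real.sq_sqrt hr.le]
      calc |g a| = √r * σ * (θ * |g a| / r) := h3
        _ ≤ _ := by
          apply mul_le_mul_of_nonneg_left _ (by positivity)
          linarith
    have h4 : |g a| ^ r ≤ (√r * σ) ^ r * (Real.exp (-r) * Real.exp (θ * |g a|)) := by
      calc |g a| ^ r ≤ (√r * σ * Real.exp (θ * |g a| / r - 1)) ^ r :=
            Real.rpow_le_rpow (abs_nonneg _) h1 hr.le
        _ = _ := by
          rw [Real.mul_rpow (by positivity) (Real.exp_pos _).le, ← Real.exp_mul, ← Real.exp_add]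
          congr 2
          field_simp
          ring
    have h5 : Real.exp (θ * |g a|) ≤ Real.exp (θ * g a) + Real.exp (-θ * g a) := by
      rcases abs_cases (g a) with ⟨h, _⟩ | ⟨h, _⟩ <;> rw [h]
      · linarith [Real.exp_pos (-θ * g a)]
      · rw [show θ * -g a = -θ * g a by ring]
        linarith [Real.exp_pos (θ * g a)]
    calc |g a| ^ r ≤ (√r * σ) ^ r * (Real.exp (-r) * Real.exp (θ * |g a|)) := h4
      _ ≤ (√r * σ) ^ r * (Real.exp (-r) * (Real.exp (θ * g a) + Real.exp (-θ * g a))) := by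
        gcongr
      _ = _ := by ring
  have hsum : ∑ a, w a * (Real.exp (θ * g a) + Real.exp (-θ * g a)) ≤ 2 * Real.exp (r / 2) := by
    have e1 : θ ^ 2 * σ ^ 2 / 2 = r / 2 := by
      rw [hθ]; field_simp; rw [Real.sq_sqrt hr.le]
    have h1 := h θ
    have h2 := h (-θ)
    rw [neg_sq, e1] at h2
    rw [e1] at h1
    simp only [mul_add, Finset.sum_add_distrib]
    linarith
  calc ∑ a, w a * |g a| ^ r
      ≤ ∑ a, w a * ((√r * σ) ^ r * Real.exp (-r) *
          (Real.exp (θ * g a) + Real.exp (-θ * g a))) := by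
        gcongr with a _
        · exact hw a
        · exact key a
    _ = (√r * σ) ^ r * Real.exp (-r) *
          ∑ a, w a * (Real.exp (θ * g a) + Real.exp (-θ * g a)) := by
        rw [Finset.mul_sum]
        refine Finset.sum_congr rfl fun a _ => by ring
    _ ≤ (√r * σ) ^ r * Real.exp (-r) * (2 * Real.exp (r / 2)) := by gcongr
    _ = 2 * (√r * σ) ^ r * (Real.exp (-r) * Real.exp (r / 2)) := by ring
    _ = _ := by rw [← Real.exp_add]; ring_nf

/-- A maximal inequality for the `p`-th moment of finitely many sub-Gaussian variables. -/
lemma exists_dominating_moment_le [Fintype α] {w : α → ℝ} (hw : ∀ a, 0 ≤ w a)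
    (hw1 : ∑ a, w a = 1) {σ : ℝ} (hσ : 0 < σ) (s : Finset β) (g : β → α → ℝ)
    (h : ∀ y ∈ s, ∀ θ : ℝ, ∑ a, w a * Real.exp (θ * g y a) ≤ Real.exp (θ ^ 2 * σ ^ 2 / 2))
    {p : ℕ} (hp : 1 ≤ p) {r : ℝ} (hpr : (p : ℝ) ≤ r)
    (hs : 2 * (s.card : ℝ) ≤ Real.exp (r / 2)) :
    ∃ G : α → ℝ, (∀ a, 0 ≤ G a) ∧ (∀ y ∈ s, ∀ a, |g y a| ≤ G a) ∧
      ∑ a, w a * G a ^ p ≤ (√r * σ) ^ p := by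
  have hp0 : (0 : ℝ) < p := by exact_mod_cast hp
  have hr : 0 < r := hp0.trans_le hpr
  have hG0 : ∀ a, 0 ≤ ∑ y ∈ s, |g y a| ^ r := fun a =>
    Finset.sum_nonneg fun y _ => Real.rpow_nonneg (abs_nonneg _) _
  -- The witness is the ℓ^r-norm over `s`. Summing the r-th moments costs 2·card, which the factor
  -- exp(-r/2) absorbs by `hs`; Jensen then lowers the exponent from r to p.
  refine ⟨fun a => (∑ y ∈ s, |g y a| ^ r) ^ (1 / r), fun a => Real.rpow_nonneg (hG0 a) _, ?_, ?_⟩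
  · intro y hy a
    calc |g y a| = (|g y a| ^ r) ^ (1 / r) := by
          rw [← Real.rpow_mul (abs_nonneg _), mul_one_div_cancel hr.ne', Real.rpow_one]
      _ ≤ _ := by
          apply Real.rpow_le_rpow (Real.rpow_nonneg (abs_nonneg _) _) _ (by positivity)
          exact Finset.single_le_sum (f := fun y => |g y a| ^ r)
            (fun y _ => Real.rpow_nonneg (abs_nonneg _) _) hy
  · have hrp : 1 ≤ r / p := by rw [le_div_iff₀ hp0]; linarith
    have hA : ∑ a, w a * ∑ y ∈ s, |g y a| ^ r ≤ (√r * σ) ^ r := by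
      calc ∑ a, w a * ∑ y ∈ s, |g y a| ^ r = ∑ y ∈ s, ∑ a, w a * |g y a| ^ r := by
            simp_rw [Finset.mul_sum]; exact Finset.sum_comm
        _ ≤ ∑ y ∈ s, 2 * (√r * σ) ^ r * Real.exp (-(r / 2)) :=
            Finset.sum_le_sum fun y hy => sum_mul_abs_rpow_le hw hσ (h y hy) hr
        _ = (√r * σ) ^ r * (2 * s.card * Real.exp (-(r / 2))) := by
            rw [Finset.sum_const, nsmul_eq_mul]; ring
        _ ≤ (√r * σ) ^ r * (Real.exp (r / 2) * Real.exp (-(r / 2))) := by gcongr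
        _ = _ := by rw [← Real.exp_add]; simp
    have hJ := Real.rpow_arith_mean_le_arith_mean_rpow Finset.univ w
      (fun a => ((∑ y ∈ s, |g y a| ^ r) ^ (1 / r)) ^ p) (fun a _ => hw a) hw1
      (fun a _ => pow_nonneg (Real.rpow_nonneg (hG0 a) _) _) hrp
    have e : ∀ a, (((∑ y ∈ s, |g y a| ^ r) ^ (1 / r)) ^ p) ^ (r / p) = ∑ y ∈ s, |g y a| ^ r := by
      intro a
      rw [← Real.rpow_natCast, ← Real.rpow_mul (hG0 a), ← Real.rpow_mul (hG0 a)]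
      rw [show 1 / r * p * (r / p) = 1 by field_simp, Real.rpow_one]
    simp_rw [e] at hJ
    have h0 : 0 ≤ ∑ a, w a * ((∑ y ∈ s, |g y a| ^ r) ^ (1 / r)) ^ p :=
      Finset.sum_nonneg fun a _ => mul_nonneg (hw a) (pow_nonneg (Real.rpow_nonneg (hG0 a) _) _)
    have h1 : (∑ a, w a * ((∑ y ∈ s, |g y a| ^ r) ^ (1 / r)) ^ p) ^ (r / p) ≤
        ((√r * σ) ^ p) ^ (r / p) := by
      refine hJ.trans (hA.trans_eq ?_)
      rw [← Real.rpow_natCast, ← Real.rpow_mul (by positivity)]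
      congr 1; field_simp
    exact (Real.rpow_le_rpow_iff h0 (by positivity) (by positivity)).1 h1

/-- Minkowski's inequality for finitely many nonnegative functions on a finite weighted space. -/
lemma sum_mul_sum_pow_le [Fintype α] {w : α → ℝ} (hw : ∀ a, 0 ≤ w a)
    (s : Finset β) (ξ : β → α → ℝ) (hξ : ∀ k ∈ s, ∀ a, 0 ≤ ξ k a)
    {b : β → ℝ} (hb : ∀ k ∈ s, 0 < b k) {p : ℕ}
    (h : ∀ k ∈ s, ∑ a, w a * ξ k a ^ p ≤ b k ^ p) (hs : s.Nonempty) :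
    ∑ a, w a * (∑ k ∈ s, ξ k a) ^ p ≤ (∑ k ∈ s, b k) ^ p := by
  set A := ∑ k ∈ s, b k with hA
  have hA0 : 0 < A := Finset.sum_pos hb hs
  -- Convexity of t^p with weights b k / A at the points ξ k / b k, each of which has p-th moment at
  -- most 1.
  have key : ∀ a, (∑ k ∈ s, ξ k a) ^ p ≤ A ^ p * ∑ k ∈ s, b k / A * (ξ k a / b k) ^ p := by
    intro a
    have hJ := Real.pow_arith_mean_le_arith_mean_pow s (fun k => b k / A) (fun k => ξ k a / b k)
      (fun k hk => div_nonneg (hb k hk).le hA0.le)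
      (by rw [← Finset.sum_div, ← hA, div_self hA0.ne'])
      (fun k hk => div_nonneg (hξ k hk a) (hb k hk).le) p
    have e : ∑ k ∈ s, ξ k a = A * ∑ k ∈ s, b k / A * (ξ k a / b k) := by
      rw [Finset.mul_sum]
      refine Finset.sum_congr rfl fun k hk => ?_
      have := (hb k hk).ne'
      field_simp
    rw [e, mul_pow]
    gcongr
  calc ∑ a, w a * (∑ k ∈ s, ξ k a) ^ p
      ≤ ∑ a, w a * (A ^ p * ∑ k ∈ s, b k / A * (ξ k a / b k) ^ p) := by
        gcongr with a _
        · exact hw a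
        · exact key a
    _ = A ^ p * ∑ k ∈ s, b k / A * ((∑ a, w a * ξ k a ^ p) / b k ^ p) := by
        simp_rw [Finset.mul_sum, Finset.sum_div, Finset.mul_sum]
        rw [Finset.sum_comm]
        refine Finset.sum_congr rfl fun k hk => Finset.sum_congr rfl fun a _ => ?_
        rw [div_pow]; ring
    _ ≤ A ^ p * ∑ k ∈ s, b k / A * 1 := by
        gcongr with k hk
        · exact div_nonneg (hb k hk).le hA0.le
        · exact div_le_one_of_le₀ (h k hk) (pow_nonneg (hb k hk).le _)
    _ = A ^ p := by
        simp only [mul_one]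
        rw [← Finset.sum_div, ← hA, div_self hA0.ne', mul_one]

/-- Hoeffding's lemma on a finite weighted space. -/
lemma sum_mul_exp_centered_le [Fintype ι] {w : ι → ℝ} (hw : ∀ i, 0 ≤ w i) (hw1 : ∑ i, w i = 1)
    {y : ι → ℝ} {B : ℝ} (hy : ∀ i, |y i| ≤ B) (θ : ℝ) :
    ∑ i, w i * Real.exp (θ * (y i - ∑ k, w k * y k)) ≤ Real.exp (θ ^ 2 * B ^ 2 / 2) := by
  classical
  let : MeasurableSpace ι := ⊤
  -- The weights become a measure so that the general Hoeffding lemma applies; [-B, B] has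
  -- half-length B, whence the variance proxy B².
  set μ : Measure ι := ∑ i, ENNReal.ofReal (w i) • Measure.dirac i with hμ
  have hprob : IsProbabilityMeasure μ := by
    constructor
    rw [hμ]
    simp [Measure.finsetSum_apply]
    rw [← ENNReal.ofReal_sum_of_nonneg fun i _ => hw i, hw1, ENNReal.ofReal_one]
  have hint : ∀ f : ι → ℝ, ∫ i, f i ∂μ = ∑ i, w i * f i := by
    intro f
    rw [hμ, integral_finsetSum_measure]
    · refine Finset.sum_congr rfl fun i _ => ?_
      rw [integral_smul_measure, integral_dirac, ENNReal.toReal_ofReal (hw i), smul_eq_mul]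
    · intro i _
      exact (integrable_dirac (by simp)).smul_measure (by simp)
  have hsub := hasSubgaussianMGF_of_mem_Icc (μ := μ) (X := y) (a := -B) (b := B)
    (by exact (measurable_from_top).aemeasurable)
    (Filter.Eventually.of_forall fun i => abs_le.1 (hy i))
  have := hsub.mgf_le θ
  rw [mgf, hint, hint] at this
  refine this.trans_eq ?_
  congr 1
  push_cast
  rw [Real.norm_eq_abs, div_pow, sq_abs]
  ring

/-- The sign attached to a Boolean. -/
def sgn (b : Bool) : ℝ := if b then 1 else -1

/-- The expectation factors into ∏ cosh(θ a j), and cosh t ≤ exp(t²/2). -/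
lemma rademacher_mgf_le {m : ℕ} (a : Fin m → ℝ) {σ : ℝ} (hσ : ∑ j, a j ^ 2 ≤ σ ^ 2) (θ : ℝ) :
    ∑ e : Fin m → Bool, (∏ _j : Fin m, (1 / 2 : ℝ)) * Real.exp (θ * ∑ j, sgn (e j) * a j) ≤
      Real.exp (θ ^ 2 * σ ^ 2 / 2) := by
  have h1 : ∀ e : Fin m → Bool, Real.exp (θ * ∑ j, sgn (e j) * a j) =
      ∏ j, Real.exp (θ * (sgn (e j) * a j)) := by
    intro e; rw [Finset.mul_sum, Real.exp_sum]
  simp_rw [h1]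
  rw [sum_prod_mul_prod (fun _ : Bool => (1 / 2 : ℝ))
    (fun j b => Real.exp (θ * (sgn b * a j)))]
  calc ∏ j, ∑ b : Bool, 1 / 2 * Real.exp (θ * (sgn b * a j))
      ≤ ∏ j, Real.exp ((θ * a j) ^ 2 / 2) := by
        refine Finset.prod_le_prod (fun j _ => by positivity) fun j _ => ?_
        refine le_trans (le_of_eq ?_) (Real.cosh_le_exp_half_sq (θ * a j))
        rw [Real.cosh_eq]
        simp [sgn]
        ring
    _ = Real.exp (θ ^ 2 * (∑ j, a j ^ 2) / 2) := by
        rw [← Real.exp_sum]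
        congr 1
        rw [Finset.mul_sum, Finset.sum_div]
        refine Finset.sum_congr rfl fun j _ => by ring
    _ ≤ _ := by gcongr

end FiniteProbability

/-! ### Maurey's empirical method -/

section Maurey

/-- A single term of the series ∑ multichoose(G, n) N^{-n} = (1 - 1/N)^{-G}, cleared of
denominators. Pascal's rule gives it by double induction. -/
lemma sub_one_pow_mul_multichoose_le {N : ℕ} (hN : 1 ≤ N) (G n : ℕ) :
    (N - 1) ^ G * Nat.multichoose G n ≤ N ^ (n + G) := by
  obtain ⟨k, rfl⟩ := Nat.exists_eq_add_of_le' hN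
  simp only [Nat.add_sub_cancel]
  induction G generalizing n with
  | zero =>
    cases n with
    | zero => simp
    | succ n => simp
  | succ G ihG =>
    induction n with
    | zero =>
      simp only [Nat.multichoose_zero_right, mul_one, zero_add]
      exact Nat.pow_le_pow_left (Nat.le_succ k) _
    | succ n ihn =>
      rw [Nat.multichoose_succ_succ, mul_add]
      have h1 := Nat.mul_le_mul_left k (ihG (n + 1))
      calc k ^ (G + 1) * G.multichoose (n + 1) + k ^ (G + 1) * (G + 1).multichoose n
          = k * (k ^ G * G.multichoose (n + 1)) + k ^ (G + 1) * (G + 1).multichoose n := by ring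
        _ ≤ k * (k + 1) ^ (n + 1 + G) + (k + 1) ^ (n + (G + 1)) := Nat.add_le_add h1 ihn
        _ = _ := by ring

/-- That is (1 - 1/N)^N ≥ 1/4: Bernoulli with exponent N/2 gives 1/2, which is then squared. -/
lemma pow_self_le_four_mul {N : ℕ} (hN : 2 ≤ N) : N ^ N ≤ 4 * (N - 1) ^ N := by
  have hN' : (2 : ℝ) ≤ N := by exact_mod_cast hN
  have hN0 : (0 : ℝ) < N := by linarith
  have h1 : (1 : ℝ) / 2 ≤ (1 + -(1 / (N : ℝ))) ^ ((N : ℝ) / 2) := by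
    have := one_add_mul_self_le_rpow_one_add (s := -(1 / (N : ℝ)))
      (by rw [neg_le_neg_iff, div_le_one hN0]; linarith) (p := (N : ℝ) / 2) (by linarith)
    refine le_trans (le_of_eq ?_) this
    field_simp; norm_num
  have hb : 0 ≤ 1 + -(1 / (N : ℝ)) := by
    have : 1 / (N : ℝ) ≤ 1 := by rw [div_le_one hN0]; linarith
    linarith
  have h2 : (1 : ℝ) / 4 ≤ (1 + -(1 / (N : ℝ))) ^ N := by
    have h3 := mul_le_mul h1 h1 (by norm_num) (by positivity)
    rw [← Real.rpow_add_of_nonneg hb (by positivity) (by positivity), add_halves,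
      Real.rpow_natCast] at h3
    linarith
  have h4 : ((N : ℝ)) ^ N ≤ 4 * ((N : ℝ) - 1) ^ N := by
    have e : (N : ℝ) - 1 = N * (1 + -(1 / (N : ℝ))) := by field_simp; ring
    rw [e, mul_pow]
    have := mul_le_mul_of_nonneg_left h2 (pow_nonneg hN0.le N)
    linarith
  have h5 : ((N - 1 : ℕ) : ℝ) = (N : ℝ) - 1 := by
    rw [Nat.cast_sub (by omega)]; simp
  rw [← h5] at h4
  exact_mod_cast h4

/-- Counting multisets rather than sequences of the 8N vertices makes the factor 8 cost only N^16,
instead of 8^n. Here (N/(N-1))^{8N} ≤ 4^8 = 2^16 ≤ N^16. -/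
lemma multichoose_eight_mul_le {N : ℕ} (hN : 2 ≤ N) (n : ℕ) :
    Nat.multichoose (N * 8) n ≤ N ^ (n + 16) := by
  have h1 := sub_one_pow_mul_multichoose_le (show 1 ≤ N by omega) (N * 8) n
  have h2 : N ^ (N * 8) ≤ 2 ^ 16 * (N - 1) ^ (N * 8) := by
    have := Nat.pow_le_pow_left (pow_self_le_four_mul hN) 8
    rw [mul_pow, ← pow_mul, ← pow_mul] at this
    simpa using this
  have h3 : (2 : ℕ) ^ 16 ≤ N ^ 16 := Nat.pow_le_pow_left hN 16
  have hpos : 0 < (N - 1) ^ (N * 8) := pow_pos (by omega) _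
  refine Nat.le_of_mul_le_mul_left (h1.trans ?_) hpos
  calc N ^ (n + N * 8) = N ^ n * N ^ (N * 8) := pow_add _ _ _
    _ ≤ N ^ n * (N ^ 16 * (N - 1) ^ (N * 8)) :=
        Nat.mul_le_mul_left _ (h2.trans (Nat.mul_le_mul_right _ h3))
    _ = _ := by ring

/-- Eight points of the unit disc. -/
def octagon : Fin 8 → ℂ :=
  ![1, -1, Complex.I, -Complex.I, ⟨0.7, 0.7⟩, ⟨0.7, -0.7⟩, ⟨-0.7, 0.7⟩, ⟨-0.7, -0.7⟩]

lemma norm_octagon_le (v : Fin 8) : ‖octagon v‖ ≤ 1 := by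
  have h : ‖octagon v‖ ^ 2 ≤ 1 := by
    rw [Complex.sq_norm, Complex.normSq_apply]
    fin_cases v <;> simp [octagon] <;> norm_num
  nlinarith [norm_nonneg (octagon v)]

/-- The ratio between the unit disc and the inner radius of the octagon. -/
def octRatio : ℝ := √(58 / 49)

lemma octRatio_pos : 0 < octRatio := Real.sqrt_pos.2 (by norm_num)

lemma octRatio_sq : octRatio ^ 2 = 58 / 49 := Real.sq_sqrt (by norm_num)

/-- By symmetry one may take 0 ≤ b ≤ a for the absolute coordinates. The best vertex changes from 1
to 0.7 + 0.7i at slope b/a = 3/7; this is the worst direction, where a²/(a² + b²) = 49/58. -/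
lemma le_octRatio_mul_re (z : ℂ) : ∃ v, ‖z‖ ≤ octRatio * (z * octagon v).re := by
  have hn : ‖z‖ ^ 2 = z.re ^ 2 + z.im ^ 2 := by
    rw [Complex.sq_norm, Complex.normSq_apply]; ring
  suffices h : ∃ v, 0 ≤ (z * octagon v).re ∧
      49 / 58 * (z.re ^ 2 + z.im ^ 2) ≤ (z * octagon v).re ^ 2 by
    obtain ⟨v, hv0, hv⟩ := h
    refine ⟨v, abs_le_of_sq_le_sq' ?_ (mul_nonneg octRatio_pos.le hv0) |>.2⟩
    rw [mul_pow, octRatio_sq, hn]; linarith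
  obtain ⟨x, y⟩ := z
  have key : ∀ a b : ℝ, 0 ≤ b → b ≤ a → 3 / 7 * a ≤ b →
      49 / 58 * (a ^ 2 + b ^ 2) ≤ (7 / 10 * (a + b)) ^ 2 := by
    intro a b hb hab h
    nlinarith [mul_nonneg (sub_nonneg.2 h) (sub_nonneg.2 hab), mul_nonneg hb hb,
      mul_nonneg (sub_nonneg.2 h) hb, mul_nonneg (sub_nonneg.2 hab) hb]
  have key2 : ∀ a b : ℝ, 0 ≤ b → b ≤ 3 / 7 * a →
      49 / 58 * (a ^ 2 + b ^ 2) ≤ a ^ 2 := by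
    intro a b hb h
    nlinarith [mul_self_le_mul_self hb h]
  have aux : ∀ a b : ℝ, 0 ≤ a → 0 ≤ b →
      49 / 58 * (a ^ 2 + b ^ 2) ≤ a ^ 2 ∨ 49 / 58 * (a ^ 2 + b ^ 2) ≤ b ^ 2 ∨
      49 / 58 * (a ^ 2 + b ^ 2) ≤ (7 / 10 * (a + b)) ^ 2 := by
    intro a b ha hb
    rcases le_total b a with hab | hab
    · rcases le_total b (3 / 7 * a) with h | h
      · exact Or.inl (key2 a b hb h)
      · exact Or.inr (Or.inr (key a b hb hab h))
    · rcases le_total a (3 / 7 * b) with h | h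
      · exact Or.inr (Or.inl (by linarith [key2 b a ha h]))
      · exact Or.inr (Or.inr (by linarith [key b a ha hab h]))
  rcases le_total 0 x with hx | hx <;> rcases le_total 0 y with hy | hy
  · rcases aux x y hx hy with h | h | h
    · exact ⟨0, by simpa [octagon] using hx, by simpa [octagon] using h⟩
    · exact ⟨3, by simpa [octagon] using hy, by simpa [octagon] using h⟩
    · refine ⟨5, ?_, h.trans_eq ?_⟩ <;> simp [octagon]
      · linarith
      · ring
  · rcases aux x (-y) hx (by linarith) with h | h | h
    · exact ⟨0, by simpa [octagon] using hx, by simpa [octagon] using h⟩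
    · exact ⟨2, by simpa [octagon] using hy, by simpa [octagon] using h⟩
    · refine ⟨4, ?_, (le_of_eq (by ring)).trans (h.trans_eq ?_)⟩ <;> simp [octagon]
      · linarith
      · ring
  · rcases aux (-x) y (by linarith) hy with h | h | h
    · exact ⟨1, by simpa [octagon] using hx, by simpa [octagon] using h⟩
    · exact ⟨3, by simpa [octagon] using hy, by simpa [octagon] using h⟩
    · refine ⟨7, ?_, (le_of_eq (by ring)).trans (h.trans_eq ?_)⟩ <;> simp [octagon]
      · linarith
      · ring
  · rcases aux (-x) (-y) (by linarith) (by linarith) with h | h | h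
    · exact ⟨1, by simpa [octagon] using hx, by simpa [octagon] using h⟩
    · exact ⟨2, by simpa [octagon] using hy, by simpa [octagon] using h⟩
    · refine ⟨6, ?_, (le_of_eq (by ring)).trans (h.trans_eq ?_)⟩ <;> simp [octagon]
      · linarith
      · ring

/-- The vertices of a polytope containing the `ℓ¹`-ball of radius `ρ`. -/
def vertex {N : ℕ} (ρ : ℝ) (k : Fin N × Fin 8) : Fin N → ℂ :=
  Pi.single k.1 (((octRatio * ρ : ℝ) : ℂ) * octagon k.2)

lemma l1Norm_eq_sum {N : ℕ} (x : Fin N → ℂ) : l1Norm x = ∑ k, ‖x k‖ := by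
  rw [l1Norm, PiLp.norm_eq_of_L1]

lemma l2Norm_sq {N : ℕ} (x : Fin N → ℂ) : l2Norm x ^ 2 = ∑ k, ‖x k‖ ^ 2 := by
  rw [l2Norm, PiLp.norm_sq_eq_of_L2]

/-- A separating real functional has the form x ↦ Re ∑ c k * x k. On the ℓ¹-ball it is at most ρ max
‖c k‖, and the octagon supplies a vertex where this value is reached. -/
lemma mem_convexHull_vertex {N : ℕ} (hN : 0 < N) {ρ : ℝ} (x : Fin N → ℂ)
    (hx : l1Norm x ≤ ρ) : x ∈ convexHull ℝ (Set.range (vertex (N := N) ρ)) := by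
  by_contra hcon
  obtain ⟨f, u, hf, hu⟩ := geometric_hahn_banach_closed_point (convex_convexHull ℝ _)
    ((Set.finite_range (vertex (N := N) ρ)).isClosed_convexHull ℝ) hcon
  rw [l1Norm_eq_sum] at hx
  have hρ : 0 ≤ ρ := le_trans (Finset.sum_nonneg fun k _ => norm_nonneg _) hx
  set c : Fin N → ℂ := fun k => ⟨f (Pi.single k 1), -f (Pi.single k Complex.I)⟩ with hc
  have hfs : ∀ k (z : ℂ), f (Pi.single k z) = (c k * z).re := by
    intro k z
    have : (Pi.single k z : Fin N → ℂ) =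
        z.re • (Pi.single k (1 : ℂ) : Fin N → ℂ) +
          z.im • (Pi.single k Complex.I : Fin N → ℂ) := by
      rw [← Pi.single_smul, ← Pi.single_smul, ← Pi.single_add]
      congr 1
      simp [Complex.re_add_im]
    rw [this, map_add, map_smul, map_smul]
    simp [hc]; ring
  have : Nonempty (Fin N) := ⟨⟨0, hN⟩⟩
  obtain ⟨k, -, hk⟩ := Finset.exists_max_image Finset.univ (fun k => ‖c k‖)
    Finset.univ_nonempty
  obtain ⟨v, hv⟩ := le_octRatio_mul_re (c k)
  have h1 : f x ≤ ρ * ‖c k‖ := by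
    calc f x = ∑ i, f (Pi.single i (x i)) := by
          rw [← map_sum, Finset.univ_sum_single]
      _ = ∑ i, (c i * x i).re := by simp_rw [hfs]
      _ ≤ ∑ i, ‖x i‖ * ‖c k‖ := by
          refine Finset.sum_le_sum fun i _ => (Complex.re_le_norm _).trans ?_
          rw [norm_mul, mul_comm]
          exact mul_le_mul_of_nonneg_left (hk i (Finset.mem_univ i)) (norm_nonneg _)
      _ ≤ ρ * ‖c k‖ := by
          rw [← Finset.sum_mul]
          exact mul_le_mul_of_nonneg_right hx (norm_nonneg _)
  have h2 : ρ * ‖c k‖ ≤ f (vertex ρ (k, v)) := by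
    rw [vertex, hfs]
    have e : (c k * (((octRatio * ρ : ℝ) : ℂ) * octagon v)).re =
        ρ * (octRatio * (c k * octagon v).re) := by
      rw [show c k * (((octRatio * ρ : ℝ) : ℂ) * octagon v) =
        ((octRatio * ρ : ℝ) : ℂ) * (c k * octagon v) by ring, Complex.re_ofReal_mul]
      ring
    rw [e]
    exact mul_le_mul_of_nonneg_left hv hρ
  have h3 := hf _ (subset_convexHull ℝ _ (Set.mem_range_self (f := vertex ρ) (k, v)))
  linarith

lemma add_rpow_le_two_rpow_mul {q : ℝ} (hq : 1 ≤ q) {a b : ℝ} (ha : 0 ≤ a) (hb : 0 ≤ b) :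
    (a + b) ^ q ≤ 2 ^ (q - 1) * (a ^ q + b ^ q) := by
  lift a to NNReal using ha
  lift b to NNReal using hb
  exact_mod_cast NNReal.rpow_add_le_mul_rpow_add_rpow a b hq

/-- Maurey's empirical method in `ℓ^{2q}`. -/
lemma exists_sample_le {ι : Type*} [Fintype ι] {w : ι → ℝ} (hw : ∀ i, 0 ≤ w i)
    (hw1 : ∑ i, w i = 1) {m n : ℕ} (hn : 0 < n) (Y : ι → Fin m → ℂ) {B : ℝ} (hB : 0 < B)
    (hY : ∀ i j, ‖Y i j‖ ≤ B) {q : ℝ} (hq : 1 ≤ q) :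
    ∃ f : Fin n → ι, ∑ j, ‖(∑ i, w i * Y i j) - (1 / n : ℝ) * ∑ l, Y (f l) j‖ ^ (2 * q) ≤
      m * (2 * (4 * q / Real.exp 1 * (B ^ 2 / n)) ^ q) := by
  classical
  have hn' : (0 : ℝ) < n := by exact_mod_cast hn
  have hq0 : 0 < q := by linarith
  set σ : ℝ := B / √n with hσ
  have hσ0 : 0 < σ := by positivity
  have hσ2 : σ ^ 2 = B ^ 2 / n := by rw [hσ, div_pow, Real.sq_sqrt hn'.le]
  -- An average of n independent samples from [-B, B], centred, is sub-Gaussian with σ = B/√n.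
  have mom : ∀ y : ι → ℝ, (∀ i, |y i| ≤ B) →
      ∑ f : Fin n → ι, (∏ l, w (f l)) *
        |(∑ i, w i * y i) - (1 / n : ℝ) * ∑ l, y (f l)| ^ (2 * q) ≤
        2 * (2 * q * (B ^ 2 / n)) ^ q * Real.exp (-q) := by
    intro y hy
    have := sum_mul_abs_rpow_le (w := fun f : Fin n → ι => ∏ l, w (f l))
      (g := fun f => (∑ i, w i * y i) - (1 / n : ℝ) * ∑ l, y (f l))
      (fun f => Finset.prod_nonneg fun l _ => hw _) hσ0 (fun θ => ?_) (r := 2 * q) (by linarith)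
    · refine this.trans_eq ?_
      rw [Real.rpow_mul (by positivity), show (√(2 * q) * σ) ^ (2 : ℝ) = 2 * q * (B ^ 2 / n) by
        rw [Real.rpow_two, mul_pow, Real.sq_sqrt (by linarith), hσ2]]
      congr 3; ring
    · have h1 : ∀ f : Fin n → ι,
          Real.exp (θ * ((∑ i, w i * y i) - (1 / n : ℝ) * ∑ l, y (f l))) =
          ∏ l, Real.exp (-θ / n * (y (f l) - ∑ i, w i * y i)) := by
        intro f
        rw [← Real.exp_sum, ← Finset.mul_sum, Finset.sum_sub_distrib, Finset.sum_const]
        congr 1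
        simp only [Finset.card_univ, Fintype.card_fin, nsmul_eq_mul]
        field_simp
        ring
      simp_rw [h1]
      rw [sum_prod_mul_prod w (fun (_ : Fin n) i => Real.exp (-θ / n * (y i - ∑ i, w i * y i)))]
      calc ∏ _l : Fin n, ∑ i, w i * Real.exp (-θ / n * (y i - ∑ i, w i * y i))
          ≤ ∏ _l : Fin n, Real.exp ((-θ / n) ^ 2 * B ^ 2 / 2) :=
            Finset.prod_le_prod
              (fun l _ => Finset.sum_nonneg fun i _ => mul_nonneg (hw i) (Real.exp_pos _).le)
              (fun l _ => sum_mul_exp_centered_le hw hw1 hy _)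
        _ = Real.exp (θ ^ 2 * σ ^ 2 / 2) := by
            rw [← Real.exp_sum, Finset.sum_const, hσ2]
            congr 1
            simp only [Finset.card_univ, Fintype.card_fin, nsmul_eq_mul]
            field_simp
  have hC : ∀ j, ∑ f : Fin n → ι, (∏ l, w (f l)) *
      ‖(∑ i, w i * Y i j) - (1 / n : ℝ) * ∑ l, Y (f l) j‖ ^ (2 * q) ≤
      2 * (4 * q / Real.exp 1 * (B ^ 2 / n)) ^ q := by
    intro j
    have hre := mom (fun i => (Y i j).re) fun i => (Complex.abs_re_le_norm _).trans (hY i j)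
    have him := mom (fun i => (Y i j).im) fun i => (Complex.abs_im_le_norm _).trans (hY i j)
    -- Splitting into real and imaginary parts costs 2^(q-1) for convexity and 2 for the two terms;
    -- the total 2^q turns 2q into 4q.
    have split : ∀ z : ℂ, ‖z‖ ^ (2 * q) ≤ 2 ^ (q - 1) * (|z.re| ^ (2 * q) + |z.im| ^ (2 * q)) := by
      intro z
      rw [Real.rpow_mul (norm_nonneg _), Real.rpow_mul (abs_nonneg _), Real.rpow_mul (abs_nonneg _)]
      simp only [Real.rpow_two, sq_abs]
      rw [Complex.sq_norm, Complex.normSq_apply, ← sq, ← sq]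
      exact add_rpow_le_two_rpow_mul hq (sq_nonneg _) (sq_nonneg _)
    calc ∑ f : Fin n → ι, (∏ l, w (f l)) *
          ‖(∑ i, w i * Y i j) - (1 / n : ℝ) * ∑ l, Y (f l) j‖ ^ (2 * q)
        ≤ ∑ f : Fin n → ι, (∏ l, w (f l)) * (2 ^ (q - 1) *
          (|(∑ i, w i * (Y i j).re) - (1 / n : ℝ) * ∑ l, (Y (f l) j).re| ^ (2 * q) +
           |(∑ i, w i * (Y i j).im) - (1 / n : ℝ) * ∑ l, (Y (f l) j).im| ^ (2 * q))) := by
          refine Finset.sum_le_sum fun f _ => mul_le_mul_of_nonneg_left ?_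
            (Finset.prod_nonneg fun l _ => hw _)
          refine (split _).trans_eq ?_
          have e1 : ((∑ i, (w i : ℂ) * Y i j) - ((1 / n : ℝ) : ℂ) * ∑ l, Y (f l) j).re =
              (∑ i, w i * (Y i j).re) - (1 / n : ℝ) * ∑ l, (Y (f l) j).re := by
            rw [Complex.sub_re, Complex.re_sum, Complex.re_ofReal_mul, Complex.re_sum]
            simp_rw [Complex.re_ofReal_mul]
          have e2 : ((∑ i, (w i : ℂ) * Y i j) - ((1 / n : ℝ) : ℂ) * ∑ l, Y (f l) j).im =
              (∑ i, w i * (Y i j).im) - (1 / n : ℝ) * ∑ l, (Y (f l) j).im := by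
            rw [Complex.sub_im, Complex.im_sum, Complex.im_ofReal_mul, Complex.im_sum]
            simp_rw [Complex.im_ofReal_mul]
          rw [e1, e2]
      _ = 2 ^ (q - 1) * (∑ f : Fin n → ι, (∏ l, w (f l)) *
            |(∑ i, w i * (Y i j).re) - (1 / n : ℝ) * ∑ l, (Y (f l) j).re| ^ (2 * q) +
          ∑ f : Fin n → ι, (∏ l, w (f l)) *
            |(∑ i, w i * (Y i j).im) - (1 / n : ℝ) * ∑ l, (Y (f l) j).im| ^ (2 * q)) := by
          rw [← Finset.sum_add_distrib, Finset.mul_sum]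
          refine Finset.sum_congr rfl fun f _ => by ring
      _ ≤ 2 ^ (q - 1) * (2 * (2 * q * (B ^ 2 / n)) ^ q * Real.exp (-q) +
            2 * (2 * q * (B ^ 2 / n)) ^ q * Real.exp (-q)) := by gcongr
      _ = 2 * (2 ^ q * (2 * q * (B ^ 2 / n)) ^ q * (1 / Real.exp 1) ^ q) := by
          rw [Real.rpow_sub_one (by norm_num), one_div, ← Real.exp_neg, ← Real.exp_mul]
          ring_nf
      _ = _ := by
          rw [← Real.mul_rpow (by norm_num) (by positivity),
            ← Real.mul_rpow (by positivity) (by positivity)]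
          congr 2; ring
  have hsum : ∑ f : Fin n → ι, (∏ l, w (f l)) *
      ∑ j, ‖(∑ i, w i * Y i j) - (1 / n : ℝ) * ∑ l, Y (f l) j‖ ^ (2 * q) ≤
      ∑ f : Fin n → ι, (∏ l, w (f l)) * (m * (2 * (4 * q / Real.exp 1 * (B ^ 2 / n)) ^ q)) := by
    rw [← Finset.sum_mul, sum_prod_weight hw1, one_mul]
    have e : ∀ f : Fin n → ι, (∏ l, w (f l)) *
        ∑ j, ‖(∑ i, w i * Y i j) - (1 / n : ℝ) * ∑ l, Y (f l) j‖ ^ (2 * q) =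
        ∑ j, (∏ l, w (f l)) * ‖(∑ i, w i * Y i j) - (1 / n : ℝ) * ∑ l, Y (f l) j‖ ^ (2 * q) :=
      fun f => Finset.mul_sum _ _ _
    rw [Finset.sum_congr rfl fun f _ => e f, Finset.sum_comm]
    refine (Finset.sum_le_sum fun j _ => hC j).trans_eq ?_
    simp
  by_contra hcon
  push Not at hcon
  -- If every sample exceeded the bound, so would the mean; strictness of that comparison needs one
  -- sample of positive weight.
  have hpos : ∃ f : Fin n → ι, 0 < ∏ l, w (f l) := by
    by_contra h
    push Not at h
    have := sum_prod_weight (κ := Fin n) hw1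
    have h0 : ∑ f : Fin n → ι, ∏ l, w (f l) ≤ 0 := Finset.sum_nonpos fun f _ => h f
    linarith
  obtain ⟨f₀, hf₀⟩ := hpos
  refine absurd hsum (not_le.2 (Finset.sum_lt_sum (fun f _ => ?_) ⟨f₀, Finset.mem_univ _, ?_⟩))
  · exact mul_le_mul_of_nonneg_left (hcon f).le (Finset.prod_nonneg fun l _ => hw _)
  · exact mul_lt_mul_of_pos_left (hcon f₀) hf₀

end Maurey

/-! ### Nets of low entropy vectors -/

section Nets

variable {m N : ℕ}

lemma norm_mulVec_le (A : Matrix (Fin m) (Fin N) ℂ) {K : ℝ} (hA : ∀ j, ‖(A j : Fin N → ℂ)‖ ≤ K)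
    (x : Fin N → ℂ) (j : Fin m) : ‖A.mulVec x j‖ ≤ K * l1Norm x := by
  rw [l1Norm_eq_sum, Finset.mul_sum]
  have h : A.mulVec x j = ∑ k, A j k * x k := rfl
  rw [h]
  refine (norm_sum_le _ _).trans (Finset.sum_le_sum fun k _ => ?_)
  rw [norm_mul]
  exact mul_le_mul_of_nonneg_right ((norm_le_pi_norm (A j) k).trans (hA j)) (norm_nonneg _)

lemma norm_mulVec_vertex_le (A : Matrix (Fin m) (Fin N) ℂ) {K : ℝ}
    (hA : ∀ j, ‖(A j : Fin N → ℂ)‖ ≤ K) {ρ : ℝ} (hρ : 0 ≤ ρ) (k : Fin N × Fin 8) (j : Fin m) :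
    ‖A.mulVec (vertex ρ k) j‖ ≤ octRatio * ρ * K := by
  have hK : 0 ≤ K := (norm_nonneg _).trans (hA j)
  have hR := octRatio_pos.le
  rw [vertex, Matrix.mulVec_single]
  simp only [Matrix.col_apply, Pi.smul_apply, MulOpposite.smul_eq_mul_unop, MulOpposite.unop_op]
  rw [norm_mul, norm_mul, Complex.norm_real, Real.norm_of_nonneg (mul_nonneg hR hρ)]
  have h1 : ‖A j k.1‖ ≤ K := (norm_le_pi_norm (A j) k.1).trans (hA j)
  have h2 := norm_octagon_le k.2
  calc ‖A j k.1‖ * (octRatio * ρ * ‖octagon k.2‖) ≤ K * (octRatio * ρ * 1) := by gcongr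
    _ = _ := by ring

/-- A finite set of averages of vertices that covers the `ℓ¹`-ball of radius `ρ`. -/
lemma exists_covering (hN : 2 ≤ N) (A : Matrix (Fin m) (Fin N) ℂ) {K : ℝ} (hK : 0 < K)
    (hA : ∀ j, ‖(A j : Fin N → ℂ)‖ ≤ K) {ρ : ℝ} (hρ : 0 < ρ) {n : ℕ} (hn : 0 < n)
    {q : ℝ} (hq : 1 ≤ q) :
    ∃ V : Finset (Fin N → ℂ), V.card ≤ N ^ (n + 16) ∧ ∀ x, l1Norm x ≤ ρ → ∃ v ∈ V,
      ∑ j, ‖A.mulVec x j - A.mulVec v j‖ ^ (2 * q) ≤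
        m * (2 * (4 * q / Real.exp 1 * ((octRatio * ρ * K) ^ 2 / n)) ^ q) := by
  classical
  -- An average of vertices depends only on the multiset sampled, so `Sym` is the right index for
  -- counting.
  let φ : Sym (Fin N × Fin 8) n → (Fin N → ℂ) := fun σ =>
    (1 / n : ℝ) • ((σ : Multiset (Fin N × Fin 8)).map (vertex ρ)).sum
  refine ⟨Finset.univ.image φ, ?_, ?_⟩
  · refine Finset.card_image_le.trans ?_
    rw [Finset.card_univ, Sym.card_sym_eq_multichoose, Fintype.card_prod, Fintype.card_fin,
      Fintype.card_fin]
    exact multichoose_eight_mul_le hN n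
  · intro x hx
    obtain ⟨ι, _, w, z, hw, hw1, hz, hxz⟩ :=
      mem_convexHull_iff_exists_fintype.1 (mem_convexHull_vertex (by omega) x hx)
    choose g hg using hz
    obtain ⟨f, hf⟩ := exists_sample_le hw hw1 hn (fun i => A.mulVec (z i))
      (B := octRatio * ρ * K) (by have := octRatio_pos; positivity)
      (fun i j => by rw [← hg i]; exact norm_mulVec_vertex_le A hA hρ.le _ j) hq
    refine ⟨φ ⟨Finset.univ.val.map (g ∘ f), by simp⟩, Finset.mem_image_of_mem _ (Finset.mem_univ _),
      ?_⟩
    refine le_trans (le_of_eq (Finset.sum_congr rfl fun j _ => ?_)) hf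
    congr 2
    congr 1
    · rw [← hxz, Matrix.mulVec_sum, Finset.sum_apply]
      refine Finset.sum_congr rfl fun i _ => ?_
      rw [Matrix.mulVec_smul]; simp
    · have e : φ ⟨Finset.univ.val.map (g ∘ f), by simp⟩ = (1 / n : ℝ) • ∑ l, z (f l) := by
        simp only [φ, Sym.coe_mk, Multiset.map_map]
        congr 1
        refine Finset.sum_congr rfl fun l _ => ?_
        simp [hg]
      rw [e, Matrix.mulVec_smul, Matrix.mulVec_sum]
      simp

/-- A finite subset of `T` that covers `T`. -/
lemma exists_internal_net (hN : 2 ≤ N) (A : Matrix (Fin m) (Fin N) ℂ) {K : ℝ} (hK : 0 < K)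
    (hA : ∀ j, ‖(A j : Fin N → ℂ)‖ ≤ K) {ρ : ℝ} (hρ : 0 < ρ) {n : ℕ} (hn : 0 < n)
    {q : ℝ} (hq : 1 ≤ q) {T : Set (Fin N → ℂ)} (hT : ∀ x ∈ T, l1Norm x ≤ ρ) {u : ℝ} (hu : 0 ≤ u)
    (hnu : 2 * (4 * q / Real.exp 1 * ((octRatio * ρ * K) ^ 2 / n)) ^ q ≤ u ^ (2 * q)) :
    ∃ S : Finset (Fin N → ℂ), ↑S ⊆ T ∧ S.card ≤ N ^ (n + 16) ∧ ∀ x ∈ T, ∃ y ∈ S,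
      ∑ j, ‖A.mulVec x j - A.mulVec y j‖ ^ (2 * q) ≤ m * (2 * u) ^ (2 * q) := by
  classical
  obtain ⟨V, hV, hcov⟩ := exists_covering hN A hK hA hρ hn hq
  have hcov' : ∀ x ∈ T, ∃ v ∈ V,
      ∑ j, ‖A.mulVec x j - A.mulVec v j‖ ^ (2 * q) ≤ m * u ^ (2 * q) := by
    intro x hx
    obtain ⟨v, hv, h⟩ := hcov x (hT x hx)
    exact ⟨v, hv, h.trans (by gcongr)⟩
  -- Net points must lie in `T` for the energy bounds to hold at them: centres far from `T` are
  -- dropped and the others are replaced by nearby points of `T`, which doubles the radius.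
  let V' := V.filter fun v => ∃ x ∈ T,
    ∑ j, ‖A.mulVec x j - A.mulVec v j‖ ^ (2 * q) ≤ m * u ^ (2 * q)
  have hV' : ∀ v ∈ V', ∃ x ∈ T,
      ∑ j, ‖A.mulVec x j - A.mulVec v j‖ ^ (2 * q) ≤ m * u ^ (2 * q) :=
    fun v hv => (Finset.mem_filter.1 hv).2
  choose! pick hpick using hV'
  refine ⟨V'.image pick, ?_, ?_, ?_⟩
  · intro y hy
    obtain ⟨v, hv, rfl⟩ := Finset.mem_image.1 (Finset.mem_coe.1 hy)
    exact (hpick v hv).1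
  · exact (Finset.card_image_le.trans (Finset.card_filter_le _ _)).trans hV
  · intro x hx
    obtain ⟨v, hv, h⟩ := hcov' x hx
    have hv' : v ∈ V' := Finset.mem_filter.2 ⟨hv, x, hx, h⟩
    refine ⟨pick v, Finset.mem_image_of_mem _ hv', ?_⟩
    have h2 := (hpick v hv').2
    have hq2 : 1 ≤ 2 * q := by linarith
    calc ∑ j, ‖A.mulVec x j - A.mulVec (pick v) j‖ ^ (2 * q)
        ≤ ∑ j, 2 ^ (2 * q - 1) * (‖A.mulVec x j - A.mulVec v j‖ ^ (2 * q) +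
            ‖A.mulVec (pick v) j - A.mulVec v j‖ ^ (2 * q)) := by
          refine Finset.sum_le_sum fun j _ => ?_
          refine le_trans (Real.rpow_le_rpow (norm_nonneg _) ?_ (by linarith))
            (add_rpow_le_two_rpow_mul hq2 (norm_nonneg _) (norm_nonneg _))
          rw [norm_sub_rev (A.mulVec (pick v) j)]
          exact norm_sub_le_norm_sub_add_norm_sub _ _ _
      _ = 2 ^ (2 * q - 1) * (∑ j, ‖A.mulVec x j - A.mulVec v j‖ ^ (2 * q) +
            ∑ j, ‖A.mulVec (pick v) j - A.mulVec v j‖ ^ (2 * q)) := by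
          rw [← Finset.mul_sum, Finset.sum_add_distrib]
      _ ≤ 2 ^ (2 * q - 1) * (m * u ^ (2 * q) + m * u ^ (2 * q)) := by gcongr
      _ = m * (2 * u) ^ (2 * q) := by
          rw [Real.mul_rpow (by norm_num) hu, Real.rpow_sub_one (by norm_num)]
          ring

end Nets

/-! ### Increments of x ↦ |Ax|² -/

section Increments

variable {ι : Type*} [Fintype ι]

/-- Jensen with weights c i / ∑ c, the case ∑ c = 0 being trivial. -/
lemma sum_mul_rpow_le {c z : ι → ℝ} (hc : ∀ i, 0 ≤ c i) (hz : ∀ i, 0 ≤ z i) {q : ℝ} (hq : 1 ≤ q) :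
    (∑ i, c i * z i) ^ q ≤ (∑ i, c i) ^ (q - 1) * ∑ i, c i * z i ^ q := by
  have hC : 0 ≤ ∑ i, c i := Finset.sum_nonneg fun i _ => hc i
  rcases hC.eq_or_lt with h0 | hpos
  · have hci : ∀ i, c i = 0 := fun i =>
      (Finset.sum_eq_zero_iff_of_nonneg fun i _ => hc i).1 h0.symm i (Finset.mem_univ i)
    simp [hci, Real.zero_rpow (by linarith : q ≠ 0)]
  · set C := ∑ i, c i with hCdef
    have hJ := Real.rpow_arith_mean_le_arith_mean_rpow Finset.univ (fun i => c i / C) z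
      (fun i _ => div_nonneg (hc i) hC) (by rw [← Finset.sum_div, ← hCdef, div_self hpos.ne'])
      (fun i _ => hz i) hq
    have e1 : ∑ i, c i * z i = C * ∑ i, c i / C * z i := by
      rw [Finset.mul_sum]
      refine Finset.sum_congr rfl fun i _ => by field_simp
    have e2 : ∑ i, c i * z i ^ q = C * ∑ i, c i / C * z i ^ q := by
      rw [Finset.mul_sum]
      refine Finset.sum_congr rfl fun i _ => by field_simp
    have h3 : 0 ≤ ∑ i, c i / C * z i :=
      Finset.sum_nonneg fun i _ => mul_nonneg (div_nonneg (hc i) hC) (hz i)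
    rw [e1, e2, Real.mul_rpow hC h3, ← mul_assoc, ← Real.rpow_add_one hpos.ne', sub_add_cancel]
    gcongr

lemma abs_normSq_sub_le (a b : ℂ) : |‖a‖ ^ 2 - ‖b‖ ^ 2| ≤ (‖a‖ + ‖b‖) * ‖a - b‖ := by
  rw [show ‖a‖ ^ 2 - ‖b‖ ^ 2 = (‖a‖ + ‖b‖) * (‖a‖ - ‖b‖) by ring, abs_mul,
    abs_of_nonneg (by positivity : 0 ≤ ‖a‖ + ‖b‖)]
  exact mul_le_mul_of_nonneg_left (abs_norm_sub_norm_le a b) (by positivity)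

lemma sum_add_sq_le {a b : ι → ℂ} {w : ℝ} (ha : ∑ j, ‖a j‖ ^ 2 ≤ w) (hb : ∑ j, ‖b j‖ ^ 2 ≤ w) :
    ∑ j, (‖a j‖ + ‖b j‖) ^ 2 ≤ 4 * w := by
  calc ∑ j, (‖a j‖ + ‖b j‖) ^ 2 ≤ ∑ j, (2 * ‖a j‖ ^ 2 + 2 * ‖b j‖ ^ 2) :=
        Finset.sum_le_sum fun j _ => by nlinarith [sq_nonneg (‖a j‖ - ‖b j‖)]
    _ = 2 * ∑ j, ‖a j‖ ^ 2 + 2 * ∑ j, ‖b j‖ ^ 2 := by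
        rw [Finset.sum_add_distrib, Finset.mul_sum, Finset.mul_sum]
    _ ≤ 4 * w := by linarith

/-- Hölder against the weight g = (‖a‖ + ‖b‖)², of total mass at most 4mW. The sup bound 4M² on g is
used only once, so after the q-th root M enters only as M^{1/q}. -/
lemma sum_sq_normSq_sub_le {m : ℕ} {a b : Fin m → ℂ} {M W d q : ℝ} (hM : 0 < M) (hW : 1 ≤ W)
    (hq : 1 ≤ q) (hd : 0 ≤ d) (haM : ∀ j, ‖a j‖ ≤ M) (hbM : ∀ j, ‖b j‖ ≤ M)
    (ha : ∑ j, ‖a j‖ ^ 2 ≤ m * W) (hb : ∑ j, ‖b j‖ ^ 2 ≤ m * W)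
    (hab : ∑ j, ‖a j - b j‖ ^ (2 * q) ≤ m * d ^ (2 * q)) :
    ∑ j, (‖a j‖ ^ 2 - ‖b j‖ ^ 2) ^ 2 ≤ (2 * M ^ (1 / q) * d * √(m * W)) ^ 2 := by
  have hq0 : 0 < q := by linarith
  have hW0 : 0 < W := by linarith
  set g : Fin m → ℝ := fun j => (‖a j‖ + ‖b j‖) ^ 2 with hg
  have hg0 : ∀ j, 0 ≤ g j := fun j => sq_nonneg _
  have hgM : ∀ j, g j ≤ 4 * M ^ 2 := fun j => by
    have h1 := haM j
    have h2 := hbM j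
    have : (‖a j‖ + ‖b j‖) ^ 2 ≤ (2 * M) ^ 2 := by gcongr; linarith
    simp only [hg]; linarith
  have hgs : ∑ j, g j ≤ 4 * (m * W) := sum_add_sq_le ha hb
  have h1 : ∑ j, (‖a j‖ ^ 2 - ‖b j‖ ^ 2) ^ 2 ≤ ∑ j, g j * ‖a j - b j‖ ^ 2 := by
    refine Finset.sum_le_sum fun j _ => ?_
    rw [← sq_abs, hg, ← mul_pow]
    gcongr
    exact abs_normSq_sub_le _ _
  refine h1.trans ?_
  have h2 := sum_mul_rpow_le (c := g) (z := fun j => ‖a j - b j‖ ^ 2) hg0 (fun j => sq_nonneg _) hq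
  have e3 : ∀ j, (‖a j - b j‖ ^ 2) ^ q = ‖a j - b j‖ ^ (2 * q) := fun j => by
    rw [Real.rpow_mul (norm_nonneg _), Real.rpow_two]
  simp_rw [e3] at h2
  have h4 : ∑ j, g j * ‖a j - b j‖ ^ (2 * q) ≤ 4 * M ^ 2 * (m * d ^ (2 * q)) := by
    calc ∑ j, g j * ‖a j - b j‖ ^ (2 * q) ≤ ∑ j, 4 * M ^ 2 * ‖a j - b j‖ ^ (2 * q) :=
          Finset.sum_le_sum fun j _ =>
            mul_le_mul_of_nonneg_right (hgM j) (Real.rpow_nonneg (norm_nonneg _) _)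
      _ ≤ _ := by rw [← Finset.mul_sum]; gcongr
  have hm0 : (0 : ℝ) ≤ m := Nat.cast_nonneg m
  have h5 : (∑ j, g j * ‖a j - b j‖ ^ 2) ^ q ≤ ((2 * M ^ (1 / q) * d * √(m * W)) ^ 2) ^ q := by
    calc (∑ j, g j * ‖a j - b j‖ ^ 2) ^ q
        ≤ (∑ j, g j) ^ (q - 1) * ∑ j, g j * ‖a j - b j‖ ^ (2 * q) := h2
      _ ≤ (4 * (m * W)) ^ (q - 1) * (4 * M ^ 2 * (m * d ^ (2 * q))) := by
          refine mul_le_mul (Real.rpow_le_rpow (Finset.sum_nonneg fun j _ => hg0 j) hgs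
            (by linarith)) h4 (Finset.sum_nonneg fun j _ =>
              mul_nonneg (hg0 j) (Real.rpow_nonneg (norm_nonneg _) _))
            (Real.rpow_nonneg (by positivity) _)
      _ ≤ (4 * (m * W)) ^ (q - 1) * (4 * (m * W)) * (M ^ 2 * d ^ (2 * q)) := by
          rw [mul_assoc ((4 * (m * W)) ^ (q - 1))]
          refine mul_le_mul_of_nonneg_left ?_ (Real.rpow_nonneg (by positivity) _)
          -- Here m ≤ mW, from 1 ≤ W, completes the exponent q - 1 to q.
          have h6 : 0 ≤ M ^ 2 * d ^ (2 * q) * m := by positivity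
          nlinarith [mul_le_mul_of_nonneg_left hW h6]
      _ = (4 * (m * W)) ^ q * (M ^ 2 * d ^ (2 * q)) := by
          rcases hm0.eq_or_lt with h | h
          · rw [← h]; simp [Real.zero_rpow hq0.ne']
          · rw [← Real.rpow_add_one (by positivity), sub_add_cancel]
      _ = _ := by
          have e6 : ((M ^ (1 / q)) ^ 2) ^ q = M ^ 2 := by
            rw [← Real.rpow_natCast (M ^ (1 / q)) 2, ← Real.rpow_mul hM.le, ← Real.rpow_mul hM.le,
              show 1 / q * ((2 : ℕ) : ℝ) * q = (2 : ℕ) by field_simp, Real.rpow_natCast]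
          have e7 : (2 * M ^ (1 / q) * d * √(m * W)) ^ 2 =
              4 * (m * W) * ((M ^ (1 / q)) ^ 2 * d ^ 2) := by
            rw [mul_pow, Real.sq_sqrt (by positivity)]; ring
          rw [e7, Real.mul_rpow (x := 4 * (m * W)) (by positivity) (by positivity),
            Real.mul_rpow (sq_nonneg _) (sq_nonneg _), e6, Real.rpow_mul hd, Real.rpow_two]
  exact (Real.rpow_le_rpow_iff (Finset.sum_nonneg fun j _ => mul_nonneg (hg0 j) (sq_nonneg _))
    (sq_nonneg _) hq0).1 h5

/-- Cauchy–Schwarz, after power means bring ℓ^{2q} down to ℓ². It bounds the end of the chain for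
all signs at once. -/
lemma sum_abs_normSq_sub_le {m : ℕ} {a b : Fin m → ℂ} {W d q : ℝ} (hW : 0 ≤ W)
    (hq : 1 ≤ q) (hd : 0 ≤ d)
    (ha : ∑ j, ‖a j‖ ^ 2 ≤ m * W) (hb : ∑ j, ‖b j‖ ^ 2 ≤ m * W)
    (hab : ∑ j, ‖a j - b j‖ ^ (2 * q) ≤ m * d ^ (2 * q)) :
    ∑ j, |‖a j‖ ^ 2 - ‖b j‖ ^ 2| ≤ 2 * d * m * √W := by
  have hq0 : 0 < q := by linarith
  have hm0 : (0 : ℝ) ≤ m := Nat.cast_nonneg m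
  have h1 : ∑ j, ‖a j - b j‖ ^ 2 ≤ m * d ^ 2 := by
    have h2 := sum_mul_rpow_le (c := fun _ : Fin m => (1 : ℝ)) (z := fun j => ‖a j - b j‖ ^ 2)
      (fun _ => zero_le_one) (fun j => sq_nonneg _) hq
    have e3 : ∀ j, (‖a j - b j‖ ^ 2) ^ q = ‖a j - b j‖ ^ (2 * q) := fun j => by
      rw [Real.rpow_mul (norm_nonneg _), Real.rpow_two]
    simp only [one_mul, e3, Finset.sum_const, Finset.card_univ, Fintype.card_fin, nsmul_eq_mul,
      mul_one] at h2
    have h5 : (∑ j, ‖a j - b j‖ ^ 2) ^ q ≤ (m * d ^ 2) ^ q := by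
      refine h2.trans ((mul_le_mul_of_nonneg_left hab (Real.rpow_nonneg hm0 _)).trans_eq ?_)
      rcases hm0.eq_or_lt with h | h
      · rw [← h]; simp [Real.zero_rpow hq0.ne']
      · rw [← mul_assoc, ← Real.rpow_add_one h.ne', sub_add_cancel,
          Real.mul_rpow hm0 (sq_nonneg d), Real.rpow_mul hd, Real.rpow_two]
    exact (Real.rpow_le_rpow_iff (Finset.sum_nonneg fun j _ => sq_nonneg _)
      (by positivity) hq0).1 h5
  calc ∑ j, |‖a j‖ ^ 2 - ‖b j‖ ^ 2| ≤ ∑ j, (‖a j‖ + ‖b j‖) * ‖a j - b j‖ :=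
        Finset.sum_le_sum fun j _ => abs_normSq_sub_le _ _
    _ ≤ √(∑ j, (‖a j‖ + ‖b j‖) ^ 2) * √(∑ j, ‖a j - b j‖ ^ 2) :=
        Real.sum_mul_le_sqrt_mul_sqrt _ _ _
    _ ≤ √(4 * (m * W)) * √(m * d ^ 2) := by
        gcongr
        exact sum_add_sq_le ha hb
    _ = 2 * d * m * √W := by
        rw [← Real.sqrt_mul (by positivity),
          show 4 * (m * W) * (m * d ^ 2) = (2 * d * m) ^ 2 * W by ring,
          Real.sqrt_mul (sq_nonneg _), Real.sqrt_sq (by positivity)]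

end Increments

/-! ### Chaining for a Rademacher process -/

section Chaining

lemma sgn_abs (b : Bool) : |sgn b| = 1 := by cases b <;> simp [sgn]

lemma abs_sum_sgn_mul_le {m : ℕ} (e : Fin m → Bool) (a : Fin m → ℝ) :
    |∑ j, sgn (e j) * a j| ≤ ∑ j, |a j| := by
  refine (Finset.abs_sum_le_sum_abs _ _).trans (le_of_eq ?_)
  simp [abs_mul, sgn_abs]

/-- Chaining along nested nets `S 0, …, S L` for a Rademacher process indexed by `T`. -/
lemma exists_chaining_bound {m : ℕ} {X : Type*} {T : Set X} (f : X → Fin m → ℝ) (L : ℕ)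
    (S : ℕ → Finset X) (hST : ∀ k ≤ L, ↑(S k) ⊆ T) (π : ℕ → X → X)
    (hπ : ∀ k ≤ L, ∀ x ∈ T, π k x ∈ S k) {σ r : ℕ → ℝ} (hσ : ∀ k ≤ L, 0 < σ k)
    (hbase : ∀ y ∈ S 0, ∑ j, f y j ^ 2 ≤ σ 0 ^ 2)
    (hstep : ∀ k < L, ∀ y ∈ S (k + 1), ∑ j, (f y j - f (π k y) j) ^ 2 ≤ σ (k + 1) ^ 2)
    {R : ℝ} (hR : 0 < R) (hres : ∀ x ∈ T, ∑ j, |f x j - f (π L x) j| ≤ R)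
    {p : ℕ} (hp : 1 ≤ p) (hpr : ∀ k ≤ L, (p : ℝ) ≤ r k)
    (hcard : ∀ k ≤ L, 2 * ((S k).card : ℝ) ≤ Real.exp (r k / 2)) :
    ∃ G : (Fin m → Bool) → ℝ, (∀ e, ∀ x ∈ T, |∑ j, sgn (e j) * f x j| ≤ G e) ∧
      ∑ e : Fin m → Bool, (∏ _j : Fin m, (1 / 2 : ℝ)) * G e ^ p ≤
        (∑ k ∈ Finset.range (L + 1), √(r k) * σ k + R) ^ p := by
  have hw : ∀ e : Fin m → Bool, 0 ≤ ∏ _j : Fin m, (1 / 2 : ℝ) := fun _ => by positivity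
  have hw1 : ∑ e : Fin m → Bool, ∏ _j : Fin m, (1 / 2 : ℝ) = 1 :=
    sum_prod_weight (κ := Fin m) (w := fun _ : Bool => (1 / 2 : ℝ)) (by simp)
  -- An increment at level k + 1 is determined by y ∈ S (k + 1) alone, so the maximal inequality
  -- pays for one net and not for pairs of points.
  let a : ℕ → X → Fin m → ℝ := fun k y j =>
    match k with
    | 0 => f y j
    | k + 1 => f y j - f (π k y) j
  have ha : ∀ k ≤ L, ∀ y ∈ S k, ∑ j, a k y j ^ 2 ≤ σ k ^ 2 := by
    intro k hk y hy
    cases k with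
    | zero => exact hbase y hy
    | succ k => exact hstep k hk y hy
  have hG : ∀ k ≤ L, ∃ G : (Fin m → Bool) → ℝ, (∀ e, 0 ≤ G e) ∧
      (∀ y ∈ S k, ∀ e, |∑ j, sgn (e j) * a k y j| ≤ G e) ∧
      ∑ e : Fin m → Bool, (∏ _j : Fin m, (1 / 2 : ℝ)) * G e ^ p ≤ (√(r k) * σ k) ^ p :=
    fun k hk => exists_dominating_moment_le hw hw1 (hσ k hk) (S k)
      (fun y (e : Fin m → Bool) => ∑ j, sgn (e j) * a k y j)
      (fun y hy θ => rademacher_mgf_le (a k y) (ha k hk y hy) θ) hp (hpr k hk) (hcard k hk)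
  choose! ξ hξ0 hξ hξp using hG
  have chain : ∀ e, ∀ k ≤ L, ∀ y ∈ S k,
      |∑ j, sgn (e j) * f y j| ≤ ∑ i ∈ Finset.range (k + 1), ξ i e := by
    intro e k
    induction k with
    | zero => intro hk y hy; simpa using hξ 0 hk y hy e
    | succ k ih =>
      intro hk y hy
      have h1 := hξ (k + 1) hk y hy e
      have h2 := ih (by omega) (π k y) (hπ k (by omega) y (hST (k + 1) hk hy))
      rw [Finset.sum_range_succ]
      have h3 : ∑ j, sgn (e j) * f y j =
          ∑ j, sgn (e j) * f (π k y) j + ∑ j, sgn (e j) * a (k + 1) y j := by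
        rw [← Finset.sum_add_distrib]
        refine Finset.sum_congr rfl fun j _ => ?_
        simp only [a]; ring
      rw [h3]
      exact (abs_add_le _ _).trans (add_le_add h2 h1)
  have hp0 : (0 : ℝ) < p := by exact_mod_cast hp
  -- The deterministic remainder R enters Minkowski's inequality as one more, constant, variable
  -- with index L + 1.
  let ξ' : ℕ → (Fin m → Bool) → ℝ := fun k e => if k ≤ L then ξ k e else R
  let b : ℕ → ℝ := fun k => if k ≤ L then √(r k) * σ k else R
  have hb : ∀ k ∈ Finset.range (L + 2), 0 < b k := by
    intro k _
    simp only [b]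
    split_ifs with h
    · exact mul_pos (Real.sqrt_pos.2 (hp0.trans_le (hpr k h))) (hσ k h)
    · exact hR
  have hξ'0 : ∀ k ∈ Finset.range (L + 2), ∀ e, 0 ≤ ξ' k e := by
    intro k _ e
    simp only [ξ']
    split_ifs with h
    · exact hξ0 k h e
    · exact hR.le
  have hbp : ∀ k ∈ Finset.range (L + 2),
      ∑ e : Fin m → Bool, (∏ _j : Fin m, (1 / 2 : ℝ)) * ξ' k e ^ p ≤ b k ^ p := by
    intro k _
    simp only [ξ', b]
    split_ifs with h
    · exact hξp k h
    · rw [← Finset.sum_mul, hw1, one_mul]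
  have hfin := sum_mul_sum_pow_le hw (Finset.range (L + 2)) ξ' hξ'0 hb hbp ⟨0, by simp⟩
  have es : ∀ e, ∑ k ∈ Finset.range (L + 2), ξ' k e =
      ∑ k ∈ Finset.range (L + 1), ξ k e + R := by
    intro e
    rw [Finset.sum_range_succ]
    congr 1
    · refine Finset.sum_congr rfl fun k hk => ?_
      simp [ξ', Nat.lt_succ_iff.1 (Finset.mem_range.1 hk)]
    · simp [ξ']
  have eb : ∑ k ∈ Finset.range (L + 2), b k =
      ∑ k ∈ Finset.range (L + 1), √(r k) * σ k + R := by
    rw [Finset.sum_range_succ]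
    congr 1
    · refine Finset.sum_congr rfl fun k hk => ?_
      simp [b, Nat.lt_succ_iff.1 (Finset.mem_range.1 hk)]
    · simp [b]
  rw [eb] at hfin
  simp_rw [es] at hfin
  refine ⟨fun e => ∑ k ∈ Finset.range (L + 1), ξ k e + R, fun e x hx => ?_, hfin⟩
  have h1 := chain e L le_rfl (π L x) (hπ L le_rfl x hx)
  have h2 : ∑ j, sgn (e j) * f x j =
      ∑ j, sgn (e j) * f (π L x) j + ∑ j, sgn (e j) * (f x j - f (π L x) j) := by
    rw [← Finset.sum_add_distrib]
    refine Finset.sum_congr rfl fun j _ => by ring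
  rw [h2]
  exact (abs_add_le _ _).trans
    (add_le_add h1 ((abs_sum_sgn_mul_le e _).trans (hres x hx)))

end Chaining

/-! ### The bound for fixed rows -/

section ConditionalBound

/-- The squared constant in Maurey's method for the `ℓ^{2q}`-norm. -/
def maureyConst (q : ℝ) : ℝ := 2 ^ (1 / q) * (4 * q / Real.exp 1)

lemma maureyConst_ge {q : ℝ} (hq : 1 ≤ q) : 1.4715 ≤ maureyConst q := by
  have h1 : (1 : ℝ) ≤ 2 ^ (1 / q) := Real.one_le_rpow (by norm_num) (by positivity)
  have h2 : 1.4715 ≤ 4 * q / Real.exp 1 := by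
    rw [le_div_iff₀ (Real.exp_pos 1)]
    nlinarith [Real.exp_one_lt_d9]
  calc (1.4715 : ℝ) ≤ 1 * (4 * q / Real.exp 1) := by linarith
    _ ≤ _ := mul_le_mul_of_nonneg_right h1 (by linarith)

/-- The number of sampled vertices at level `k`. -/
def netOrder (q : ℝ) (k : ℕ) : ℕ :=
  ⌈64 * (58 / 49) * maureyConst q * Real.exp k ^ 2⌉₊

/-- The moment used at level `k`. -/
def netMoment (N p : ℕ) (q : ℝ) (k : ℕ) : ℝ :=
  max p (2 * Real.log (2 * (N : ℝ) ^ (netOrder q k + 16)))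

/-- The sum over the levels of the chain. -/
def chainSum (N p L : ℕ) (q M : ℝ) : ℝ :=
  √(netMoment N p q 0) * M +
    ∑ k ∈ Finset.range L, √(netMoment N p q (k + 1)) * (M ^ (1 / q) * (M / 2 * Real.exp (-k)))

lemma exists_rademacher_bound {m N : ℕ} (hm : 0 < m) (hN : 2 ≤ N) (A : Matrix (Fin m) (Fin N) ℂ)
    {K ρ : ℝ} (hK : 0 < K) (hρ : 0 < ρ) (hA : ∀ j, ‖(A j : Fin N → ℂ)‖ ≤ K)
    {T : Set (Fin N → ℂ)} (hT : ∀ x ∈ T, l1Norm x ≤ ρ) {W : ℝ} (hW : 1 ≤ W)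
    (hTW : ∀ x ∈ T, ∑ j, ‖A.mulVec x j‖ ^ 2 ≤ m * W) {p : ℕ} (hp : 1 ≤ p) {q : ℝ} (hq : 1 ≤ q)
    (L : ℕ) :
    ∃ G : (Fin m → Bool) → ℝ,
      (∀ e, ∀ x ∈ T, |∑ j, sgn (e j) * ‖A.mulVec x j‖ ^ 2| ≤ G e) ∧
      ∑ e : Fin m → Bool, (∏ _j : Fin m, (1 / 2 : ℝ)) * G e ^ p ≤
        (√(m * W) * chainSum N p L q (K * ρ) + m * √W * (K * ρ / 2 * Real.exp (-L))) ^ p := by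
  classical
  set M := K * ρ with hM
  have hM0 : 0 < M := by positivity
  have hm' : (0 : ℝ) < m := by exact_mod_cast hm
  have hW0 : 0 < W := by linarith
  have hq0 : 0 < q := by linarith
  have hc := maureyConst_ge hq
  have hMA : ∀ x ∈ T, ∀ j, ‖A.mulVec x j‖ ≤ M := fun x hx j =>
    (norm_mulVec_le A hA x j).trans (mul_le_mul_of_nonneg_left (hT x hx) hK.le)
  -- `netOrder` is calibrated to this radius: its 64 is 8² and its 58/49 is `octRatio` squared.
  let u : ℕ → ℝ := fun k => M / 8 * Real.exp (-k)
  have hu : ∀ k, 0 < u k := fun k => by simp only [u]; positivity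
  have hn : ∀ k, 0 < netOrder q k := fun k => Nat.ceil_pos.2 (by positivity)
  have hnet : ∀ k, ∃ S : Finset (Fin N → ℂ), ↑S ⊆ T ∧ S.card ≤ N ^ (netOrder q k + 16) ∧
      ∀ x ∈ T, ∃ y ∈ S, ∑ j, ‖A.mulVec x j - A.mulVec y j‖ ^ (2 * q) ≤
        m * (2 * u k) ^ (2 * q) := by
    intro k
    refine exists_internal_net hN A hK hA hρ (hn k) hq hT (hu k).le ?_
    have hn' : (0 : ℝ) < netOrder q k := by exact_mod_cast hn k
    have hle : 64 * (58 / 49) * maureyConst q * Real.exp k ^ 2 ≤ netOrder q k := Nat.le_ceil _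
    have e1 : 2 * (4 * q / Real.exp 1 * ((octRatio * ρ * K) ^ 2 / netOrder q k)) ^ q =
        (maureyConst q * (58 / 49 * M ^ 2 / netOrder q k)) ^ q := by
      have h2 : (2 : ℝ) = (2 ^ (1 / q)) ^ q := by
        rw [← Real.rpow_mul (by norm_num), one_div_mul_cancel hq0.ne', Real.rpow_one]
      have h3 : (octRatio * ρ * K) ^ 2 = 58 / 49 * M ^ 2 := by
        rw [hM, mul_assoc, mul_pow, octRatio_sq]; ring
      rw [h3]
      nth_rewrite 1 [h2]
      rw [← Real.mul_rpow (by positivity) (by positivity), maureyConst]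
      congr 1; ring
    rw [e1, Real.rpow_mul (hu k).le, Real.rpow_two]
    refine Real.rpow_le_rpow (by positivity) ?_ hq0.le
    have e2 : u k ^ 2 = M ^ 2 / (64 * Real.exp k ^ 2) := by
      simp only [u, Real.exp_neg]; field_simp; norm_num
    rw [e2, mul_div_assoc', div_le_div_iff₀ hn' (by positivity)]
    calc maureyConst q * (58 / 49 * M ^ 2) * (64 * Real.exp k ^ 2)
        = M ^ 2 * (64 * (58 / 49) * maureyConst q * Real.exp k ^ 2) := by ring
      _ ≤ M ^ 2 * netOrder q k := by gcongr
  choose S hST hScard hScov using hnet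
  have hπ' : ∀ k, ∃ π : (Fin N → ℂ) → (Fin N → ℂ), ∀ x ∈ T, π x ∈ S k ∧
      ∑ j, ‖A.mulVec x j - A.mulVec (π x) j‖ ^ (2 * q) ≤ m * (2 * u k) ^ (2 * q) := by
    intro k
    have := hScov k
    choose! π hπ using this
    exact ⟨π, fun x hx => hπ x hx⟩
  choose π hπ using hπ'
  have hmW : 0 < √(m * W) := Real.sqrt_pos.2 (by positivity)
  -- A step from level k + 1 ends in the net of level k, so its size is governed by u k. Level 0
  -- uses only ‖(Ax) j‖ ≤ M.
  let σ : ℕ → ℝ := fun k => match k with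
    | 0 => M * √(m * W)
    | k + 1 => M ^ (1 / q) * (M / 2 * Real.exp (-k)) * √(m * W)
  have hσ : ∀ k, 0 < σ k := by
    intro k; cases k <;> simp only [σ] <;> positivity
  have key := exists_chaining_bound (T := T) (fun x j => ‖A.mulVec x j‖ ^ 2) L S
    (fun k _ => hST k) π (fun k _ x hx => (hπ k x hx).1) (σ := σ)
    (r := netMoment N p q) (fun k _ => hσ k) ?_ ?_
    (R := m * √W * (M / 2 * Real.exp (-L))) (by positivity) ?_ hp
    (fun k _ => le_max_left _ _) ?_
  · obtain ⟨G, hG1, hG2⟩ := key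
    refine ⟨G, hG1, hG2.trans_eq ?_⟩
    congr 2
    rw [Finset.sum_range_succ', chainSum, mul_add, Finset.mul_sum, add_comm]
    congr 1
    · simp only [σ]; ring
    · refine Finset.sum_congr rfl fun k _ => ?_
      simp only [σ]; ring
  · intro y hy
    have hyT := hST 0 hy
    calc ∑ j, (‖A.mulVec y j‖ ^ 2) ^ 2 ≤ ∑ j, M ^ 2 * ‖A.mulVec y j‖ ^ 2 := by
          refine Finset.sum_le_sum fun j _ => ?_
          rw [sq (‖A.mulVec y j‖ ^ 2)]
          have := hMA y hyT j
          gcongr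
      _ ≤ M ^ 2 * (m * W) := by
          rw [← Finset.mul_sum]
          exact mul_le_mul_of_nonneg_left (hTW y hyT) (sq_nonneg _)
      _ = σ 0 ^ 2 := by
          simp only [σ]; rw [mul_pow M, Real.sq_sqrt (by positivity)]
  · intro k _ y hy
    have hyT := hST (k + 1) hy
    have hz := hπ k y hyT
    have hzT := hST k hz.1
    refine (sum_sq_normSq_sub_le hM0 hW hq (by linarith [hu k] : 0 ≤ 2 * u k) (hMA y hyT)
      (hMA _ hzT) (hTW y hyT) (hTW _ hzT) hz.2).trans_eq ?_
    simp only [σ, u]; ring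
  · intro x hx
    have hz := hπ L x hx
    have hzT := hST L hz.1
    refine (sum_abs_normSq_sub_le hW0.le hq (by linarith [hu L] : 0 ≤ 2 * u L)
      (hTW x hx) (hTW _ hzT) hz.2).trans_eq ?_
    simp only [u]; ring
  · intro k _
    have hN0 : (0 : ℝ) < N := by exact_mod_cast (by omega : 0 < N)
    calc 2 * ((S k).card : ℝ) ≤ 2 * (N : ℝ) ^ (netOrder q k + 16) := by
          gcongr; exact_mod_cast hScard k
      _ = Real.exp (2 * Real.log (2 * (N : ℝ) ^ (netOrder q k + 16)) / 2) := by
          rw [mul_div_cancel_left₀ _ two_ne_zero, Real.exp_log (by positivity)]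
      _ ≤ _ := by
          gcongr
          exact le_max_right _ _

end ConditionalBound

/-! ### Numerical evaluation of the chain -/

section Numerics

/-- With t = log M² and q = 1 + t, the factor (M^{1/q})² = e^{t/q} nearly cancels the 1/e in
`maureyConst`, leaving 4q exp(-(1 - log 2)/q) ≤ 4q²/(q + 1 - log 2). The term (3/4) log 2, which
becomes the 2^{3/4} of the theorem, keeps the bound valid down to M = 1. -/
lemma maureyConst_mul_le {M : ℝ} (hM : 1 ≤ M) :
    maureyConst (1 + Real.log (M ^ 2)) * (M ^ (1 / (1 + Real.log (M ^ 2)))) ^ 2 ≤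
      6 * (Real.log (M ^ 2) + 3 / 4 * Real.log 2) := by
  have hM0 : 0 < M := by linarith
  set t := Real.log (M ^ 2) with ht
  have ht0 : 0 ≤ t := Real.log_nonneg (by nlinarith)
  set q := 1 + t with hq
  have hq1 : 1 ≤ q := by linarith
  have hq0 : 0 < q := by linarith
  have hl1 := Real.log_two_gt_d9
  have hl2 := Real.log_two_lt_d9
  have e1 : (M ^ (1 / q)) ^ 2 = Real.exp (t / q) := by
    rw [← Real.rpow_natCast, ← Real.rpow_mul hM0.le, Real.rpow_def_of_pos hM0, ht, Real.log_pow]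
    congr 1; push_cast; ring
  have e2 : (2 : ℝ) ^ (1 / q) = Real.exp (Real.log 2 / q) := by
    rw [Real.rpow_def_of_pos (by norm_num)]; congr 1; ring
  have e3 : maureyConst q * (M ^ (1 / q)) ^ 2 = 4 * q * Real.exp (-((1 - Real.log 2) / q)) := by
    rw [maureyConst, e1, e2]
    calc Real.exp (Real.log 2 / q) * (4 * q / Real.exp 1) * Real.exp (t / q)
        = 4 * q * (Real.exp (Real.log 2 / q) * Real.exp (-1) * Real.exp (t / q)) := by
          rw [Real.exp_neg]; ring
      _ = _ := by
          rw [← Real.exp_add, ← Real.exp_add]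
          congr 2
          rw [show t = q - 1 by rw [hq]; ring]
          field_simp; ring
  rw [e3, Real.exp_neg]
  have h4 := Real.add_one_le_exp ((1 - Real.log 2) / q)
  have h5 : 0 < (1 - Real.log 2) / q + 1 := by
    have : 0 < 1 - Real.log 2 := by linarith
    positivity
  calc 4 * q * (Real.exp ((1 - Real.log 2) / q))⁻¹ ≤ 4 * q * ((1 - Real.log 2) / q + 1)⁻¹ := by
        gcongr
    _ = 4 * q ^ 2 / (1 - Real.log 2 + q) := by field_simp
    _ ≤ 6 * (t + 3 / 4 * Real.log 2) := by
        rw [div_le_iff₀ (by linarith), show t = q - 1 by rw [hq]; ring]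
        have ha : q - 0.4802 ≤ q - 1 + 3 / 4 * Real.log 2 := by linarith
        have hb : q + 0.3068 ≤ 1 - Real.log 2 + q := by linarith
        have hc : (q - 0.4802) * (q + 0.3068) ≤
            (q - 1 + 3 / 4 * Real.log 2) * (1 - Real.log 2 + q) :=
          mul_le_mul ha hb (by linarith) (by linarith)
        nlinarith

/-- The exponent log M / (1 + 2 log M) is at most 1/2, and √e ≤ 2. -/
lemma rpow_inv_le {M : ℝ} (hM : 1 ≤ M) : M ^ (1 / (1 + Real.log (M ^ 2))) ≤ 2 := by
  have hM0 : 0 < M := by linarith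
  have ht0 : 0 ≤ Real.log M := Real.log_nonneg hM
  rw [Real.rpow_def_of_pos hM0, Real.log_pow]
  have h1 : Real.log M * (1 / (1 + (2 : ℕ) * Real.log M)) ≤ 1 / 2 := by
    rw [mul_one_div, div_le_iff₀ (by push_cast; linarith)]
    push_cast; linarith
  have h2 : Real.exp (1 / 2) ^ 2 = Real.exp 1 := by
    rw [← Real.exp_nat_mul]; norm_num
  have h3 := Real.exp_one_lt_d9
  have h4 := Real.exp_pos (1 / 2 : ℝ)
  refine (Real.exp_le_exp.2 h1).trans ?_
  nlinarith

/-- Separates the part due to ε from the entropy of the net. The decimals come from 1.5² ≥ 2 and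
13.27² ≥ 176. -/
lemma sqrt_netMoment_le {N p : ℕ} (hN : 2 ≤ N) {q x : ℝ} (hq : 1 ≤ q) (hx : 0 ≤ x)
    (hp : (p : ℝ) ≤ 2 * x + 1) (k : ℕ) :
    √(netMoment N p q k) ≤ 1.5 * √x + 13.27 * √(Real.log N) * √(maureyConst q) * Real.exp k := by
  have hc := maureyConst_ge hq
  have hN' : (2 : ℝ) ≤ N := by exact_mod_cast hN
  have hl1 := Real.log_two_gt_d9
  have hlN : Real.log 2 ≤ Real.log N := Real.log_le_log (by norm_num) hN'
  have hek : 1 ≤ Real.exp k := Real.one_le_exp (Nat.cast_nonneg k)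
  have hn : (netOrder q k : ℝ) ≤ 64 * (58 / 49) * maureyConst q * Real.exp k ^ 2 + 1 :=
    (Nat.ceil_lt_add_one (by positivity)).le
  have hlog : Real.log (2 * (N : ℝ) ^ (netOrder q k + 16)) =
      Real.log 2 + (netOrder q k + 16) * Real.log N := by
    rw [Real.log_mul (by norm_num) (by positivity), Real.log_pow]; push_cast; ring
  have hce : 1.4715 ≤ maureyConst q * Real.exp k ^ 2 := by
    nlinarith [one_le_pow₀ hek (n := 2)]
  have h1 : netMoment N p q k ≤ 2 * x + 176 * (maureyConst q * Real.exp k ^ 2) * Real.log N := by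
    refine max_le ?_ ?_
    · have : 1.4715 * 0.69 ≤ maureyConst q * Real.exp k ^ 2 * Real.log N :=
        mul_le_mul hce (by linarith) (by norm_num) (by linarith)
      linarith
    · rw [hlog]
      -- The 17 includes one log N dominating log 2. Since 64·58/49 < 75.76, the remaining 18 must
      -- fit into about 12.24 times the quantity bounded in `hce`.
      have hn' : (netOrder q k : ℝ) + 17 ≤ 88 * (maureyConst q * Real.exp k ^ 2) := by
        nlinarith
      have := mul_le_mul_of_nonneg_right hn' (by linarith : 0 ≤ Real.log N)
      linarith
  have hs : (1.5 * √x + 13.27 * √(Real.log N) * √(maureyConst q) * Real.exp k) ^ 2 ≥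
      2 * x + 176 * (maureyConst q * Real.exp k ^ 2) * Real.log N := by
    have ha := Real.sq_sqrt hx
    have hb := Real.sq_sqrt (by linarith : 0 ≤ Real.log N)
    have hd := Real.sq_sqrt (by linarith : 0 ≤ maureyConst q)
    have e : (13.27 * √(Real.log N) * √(maureyConst q) * Real.exp k) ^ 2 =
        176.0929 * (maureyConst q * Real.exp k ^ 2) * Real.log N := by
      rw [mul_pow, mul_pow, mul_pow, hb, hd]; norm_num; ring
    have hpos : 0 ≤ maureyConst q * Real.exp k ^ 2 * Real.log N :=
      mul_nonneg (by linarith) (by linarith)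
    have hcross : 0 ≤ 1.5 * √x * (13.27 * √(Real.log N) * √(maureyConst q) * Real.exp k) := by
      positivity
    rw [add_sq, e, mul_pow, ha]
    nlinarith
  exact Real.sqrt_le_iff.2 ⟨by positivity, h1.trans hs⟩

lemma sum_exp_neg_le (L : ℕ) : ∑ k ∈ Finset.range L, Real.exp (-(k : ℝ)) ≤ 2 := by
  have h1 : ∀ k : ℕ, Real.exp (-(k : ℝ)) ≤ (1 / 2 : ℝ) ^ k := by
    intro k
    have h2 : Real.exp (-1) ≤ 1 / 2 := by
      rw [Real.exp_neg, one_div]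
      exact inv_anti₀ (by norm_num) (by linarith [Real.exp_one_gt_d9])
    calc Real.exp (-(k : ℝ)) = Real.exp (-1) ^ k := by
          rw [← Real.exp_nat_mul]; congr 1; ring
      _ ≤ _ := by gcongr
  refine (Finset.sum_le_sum fun k _ => h1 k).trans ?_
  have := sum_geometric_two_le L
  simpa using this

/-- Brings the chain into the shape of the hypothesis on m, with x = log(1/ε) and y the logarithm of
the depth scale. The factor 32 / log 2 exceeds 46 = 2·23, and 2.4495 exceeds √6. -/
lemma two_mul_chainSum_le {N p L : ℕ} (hN : 2 ≤ N) {M x y : ℝ} (hM : 1 ≤ M) (hx : 0 ≤ x)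
    (hy : 0 ≤ y) (hp : (p : ℝ) ≤ 2 * x + 1) (hL : (L : ℝ) ≤ y + 1) :
    2 * chainSum N p L (1 + Real.log (M ^ 2)) M ≤ 32 / Real.log 2 * M *
      (√(Real.log (M ^ 2) + 3 / 4 * Real.log 2) * (2 * y + 1 + 6 * Real.log 2) *
        √(Real.log N) + √x) := by
  have ht0 : 0 ≤ Real.log (M ^ 2) := Real.log_nonneg (by nlinarith)
  have hmul := maureyConst_mul_le hM
  have hroot := rpow_inv_le hM
  have hroot1 : 1 ≤ M ^ (1 / (1 + Real.log (M ^ 2))) := Real.one_le_rpow hM (by positivity)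
  set t := Real.log (M ^ 2) with ht
  set q := 1 + t with hq
  have hq1 : 1 ≤ q := by linarith
  have hl1 := Real.log_two_gt_d9
  have hl2 := Real.log_two_lt_d9
  have hc := maureyConst_ge hq1
  set z := M ^ (1 / q) with hz
  set c := √(maureyConst q) with hcdef
  have hc0 : 0 ≤ c := Real.sqrt_nonneg _
  set ℓ := √(Real.log N) with hℓ
  have hℓ0 : 0 ≤ ℓ := Real.sqrt_nonneg _
  set Λ := √(t + 3 / 4 * Real.log 2) with hΛ
  have hΛ0 : 0 ≤ Λ := Real.sqrt_nonneg _
  have hX0 : 0 ≤ √x := Real.sqrt_nonneg _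
  have hr := sqrt_netMoment_le hN hq1 hx hp
  have hM0 : 0 < M := by linarith
  have hcz : c * z ≤ 2.4495 * Λ := by
    refine abs_le_of_sq_le_sq' ?_ (by positivity) |>.2
    rw [mul_pow, mul_pow, hcdef, hΛ, Real.sq_sqrt (by linarith), Real.sq_sqrt (by linarith)]
    refine hmul.trans ?_
    have : 0 ≤ t + 3 / 4 * Real.log 2 := by linarith
    nlinarith
  -- In the entropy part e^{k+1} from the net cancels e^{-k} from the scale, so each level adds the
  -- same amount and the sum is linear in L. The part with √x is geometric.
  have hsum : ∑ k ∈ Finset.range L, √(netMoment N p q (k + 1)) *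
      (z * (M / 2 * Real.exp (-k))) ≤
      M * (3 * √x + (13.27 * ℓ * (c * z)) * (Real.exp 1 / 2 * L)) := by
    calc ∑ k ∈ Finset.range L, √(netMoment N p q (k + 1)) * (z * (M / 2 * Real.exp (-k)))
        ≤ ∑ k ∈ Finset.range L, (1.5 * √x + 13.27 * ℓ * c * Real.exp ((k + 1 : ℕ) : ℝ)) *
            (z * (M / 2 * Real.exp (-k))) := by
          gcongr with k _
          exact hr (k + 1)
      _ = ∑ k ∈ Finset.range L, (1.5 * √x * z * (M / 2) * Real.exp (-k) +
            M * ((13.27 * ℓ * (c * z)) * (Real.exp 1 / 2))) := by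
          refine Finset.sum_congr rfl fun k _ => ?_
          push_cast
          rw [Real.exp_add, Real.exp_neg]
          field_simp
      _ = 1.5 * √x * z * (M / 2) * ∑ k ∈ Finset.range L, Real.exp (-(k : ℝ)) +
            L * (M * ((13.27 * ℓ * (c * z)) * (Real.exp 1 / 2))) := by
          rw [Finset.sum_add_distrib, ← Finset.mul_sum, Finset.sum_const, Finset.card_range,
            nsmul_eq_mul]
      _ ≤ 1.5 * √x * 2 * (M / 2) * 2 +
            L * (M * ((13.27 * ℓ * (c * z)) * (Real.exp 1 / 2))) := by
          have := sum_exp_neg_le L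
          gcongr
      _ = _ := by ring
  have h0 : √(netMoment N p q 0) * M ≤ M * (1.5 * √x + 13.27 * ℓ * (c * z)) := by
    have h1 := hr 0
    simp only [Nat.cast_zero, Real.exp_zero, mul_one] at h1
    rw [mul_comm]
    have h2 : 13.27 * ℓ * c ≤ 13.27 * ℓ * (c * z) := by
      apply mul_le_mul_of_nonneg_left _ (by positivity)
      exact le_mul_of_one_le_right hc0 hroot1
    apply mul_le_mul_of_nonneg_left _ hM0.le
    linarith
  have hcs : chainSum N p L q M ≤
      M * (4.5 * √x + 13.27 * ℓ * (c * z) * (1 + Real.exp 1 / 2 * L)) := by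
    rw [chainSum]
    refine (add_le_add h0 hsum).trans_eq ?_
    ring
  have he := Real.exp_one_lt_d9
  have hmain : 13.27 * ℓ * (c * z) * (1 + Real.exp 1 / 2 * L) ≤
      Λ * ℓ * (77 + 44.2 * y) := by
    calc 13.27 * ℓ * (c * z) * (1 + Real.exp 1 / 2 * L)
        ≤ 13.27 * ℓ * (2.4495 * Λ) * (1 + 1.35915 * (y + 1)) := by
          gcongr
          linarith
      _ = Λ * ℓ * (32.504865 * (2.35915 + 1.35915 * y)) := by ring
      _ ≤ _ := by
          gcongr
          linarith
  have hconst : 46 ≤ 32 / Real.log 2 := by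
    rw [le_div_iff₀ (by linarith)]; linarith
  calc 2 * chainSum N p L q M
      ≤ 2 * (M * (4.5 * √x + Λ * ℓ * (77 + 44.2 * y))) := by
        gcongr
        exact hcs.trans (by gcongr)
    _ ≤ 46 * M * (Λ * (2 * y + 1 + 6 * Real.log 2) * ℓ + √x) := by
        have h1 : 77 + 44.2 * y ≤ 23 * (2 * y + 1 + 6 * Real.log 2) := by linarith
        have h2 : Λ * ℓ * (77 + 44.2 * y) ≤ Λ * ℓ * (23 * (2 * y + 1 + 6 * Real.log 2)) := by
          gcongr
        have h3 : 4.5 * √x + Λ * ℓ * (77 + 44.2 * y) ≤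
            23 * (Λ * (2 * y + 1 + 6 * Real.log 2) * ℓ + √x) := by linarith
        have := mul_le_mul_of_nonneg_left h3 hM0.le
        linarith
    _ ≤ _ := by gcongr

end Numerics

/-! ### Suprema over compact sets -/

section SupAbs

variable {Y : Type*}

/-- The supremum of `|h|` over `T`. -/
def supAbs (T : Set Y) (h : Y → ℝ) : ℝ := sSup ((fun x => |h x|) '' T)

lemma supAbs_nonneg (T : Set Y) (h : Y → ℝ) : 0 ≤ supAbs T h :=
  Real.sSup_nonneg (by rintro _ ⟨x, -, rfl⟩; exact abs_nonneg _)

lemma supAbs_le {T : Set Y} {h : Y → ℝ} {c : ℝ} (hc : 0 ≤ c) (hh : ∀ x ∈ T, |h x| ≤ c) :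
    supAbs T h ≤ c :=
  Real.sSup_le (by rintro _ ⟨x, hx, rfl⟩; exact hh x hx) hc

variable [TopologicalSpace Y]

lemma le_supAbs {T : Set Y} (hT : IsCompact T) {h : Y → ℝ} (hh : Continuous h) {x : Y}
    (hx : x ∈ T) : |h x| ≤ supAbs T h :=
  le_csSup (hT.bddAbove_image hh.abs.continuousOn) ⟨x, hx, rfl⟩

/-- Joint continuity and compactness make the supremum continuous in the parameter, hence
measurable. -/
lemma continuous_supAbs {T : Set Y} (hT : IsCompact T) {X : Type*} [TopologicalSpace X]
    {h : X → Y → ℝ} (hh : Continuous fun z : X × Y => h z.1 z.2) :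
    Continuous fun a => supAbs T (h a) :=
  hT.continuous_sSup (f := fun a x => |h a x|) hh.abs

end SupAbs

/-! ### Symmetrization -/

section Symmetrization

variable {E : Type*} [MeasurableSpace E] {m : ℕ}

/-- Exchange the coordinates of a pair where `e` is false. -/
def swapBy (e : Fin m → Bool) (z : (Fin m → E) × (Fin m → E)) : (Fin m → E) × (Fin m → E) :=
  (fun j => if e j then z.1 j else z.2 j, fun j => if e j then z.2 j else z.1 j)

/-- Regrouped as a family of independent pairs, each pair is exchangeable. -/
lemma measurePreserving_swapBy (μ : Fin m → Measure E) [∀ j, IsProbabilityMeasure (μ j)]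
    (e : Fin m → Bool) :
    MeasurePreserving (swapBy e) ((Measure.pi μ).prod (Measure.pi μ))
      ((Measure.pi μ).prod (Measure.pi μ)) := by
  have h1 := measurePreserving_arrowProdEquivProdArrow E E (Fin m) μ μ
  have h2 : MeasurePreserving
      (fun (a : Fin m → E × E) j => (if e j then (id : E × E → E × E) else Prod.swap) (a j))
      (.pi fun j => (μ j).prod (μ j)) (.pi fun j => (μ j).prod (μ j)) := by
    refine measurePreserving_pi _ _ fun j => ?_
    cases e j
    · simpa using Measure.measurePreserving_swap
    · simpa using MeasurePreserving.id _
  have h3 := (h1.comp h2).comp (h1.symm)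
  convert h3 using 1
  funext z
  refine Prod.ext (funext fun j => ?_) (funext fun j => ?_) <;>
  · simp only [swapBy, Function.comp, MeasurableEquiv.arrowProdEquivProdArrow]
    cases h : e j <;> simp [h, Equiv.arrowProdEquivProdArrow]

variable [TopologicalSpace E] [SecondCountableTopology E] [BorelSpace E]
  {Y : Type*} [TopologicalSpace Y]

/-- Symmetrization for the `p`-th moment of the supremum of a centered empirical process. -/
lemma integral_supAbs_pow_le_two_pow_mul (μ : Fin m → Measure E) [∀ j, IsProbabilityMeasure (μ j)]
    {T : Set Y} (hT : IsCompact T) {F : E → Y → ℝ}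
    (hF : Continuous fun z : E × Y => F z.1 z.2) {C : ℝ} (hC : 0 ≤ C)
    (hb : ∀ j, ∀ᵐ v ∂μ j, ∀ x ∈ T, |F v x| ≤ C) {a : ℝ}
    (ha : ∀ j, ∀ x ∈ T, ∫ v, F v x ∂μ j = a) {p : ℕ} (hp : 1 ≤ p) (e : Fin m → Bool) :
    ∫ X, supAbs T (fun x => ∑ j, (F (X j) x - a)) ^ p ∂Measure.pi μ ≤
      2 ^ p * ∫ X, supAbs T (fun x => ∑ j, sgn (e j) * F (X j) x) ^ p ∂Measure.pi μ := by
  set ν := Measure.pi μ with hν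
  have hFj : ∀ j, Continuous fun z : (Fin m → E) × Y => F (z.1 j) z.2 := fun j =>
    hF.comp (f := fun z : (Fin m → E) × Y => (z.1 j, z.2)) (by fun_prop)
  have hFx : ∀ v, Continuous (F v) := fun v => hF.comp (f := fun x => (v, x)) (by fun_prop)
  have hFv : ∀ x, Continuous fun v => F v x := fun x => hF.comp (f := fun v => (v, x)) (by fun_prop)
  have hbν : ∀ᵐ X ∂ν, ∀ j, ∀ x ∈ T, |F (X j) x| ≤ C := by
    rw [ae_all_iff]
    intro j
    exact (measurePreserving_eval μ j).quasiMeasurePreserving.ae (hb j)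
  let U : (Fin m → E) × (Fin m → E) → ℝ := fun z =>
    supAbs T (fun x => ∑ j, (F (z.1 j) x - F (z.2 j) x))
  have hU0 : ∀ z, 0 ≤ U z := fun z => supAbs_nonneg _ _
  have hUc : Continuous U := by
    refine continuous_supAbs hT (continuous_finsetSum _ fun j _ => Continuous.sub ?_ ?_)
    · exact (hFj j).comp
        (f := fun z : ((Fin m → E) × (Fin m → E)) × Y => (z.1.1, z.2)) (by fun_prop)
    · exact (hFj j).comp
        (f := fun z : ((Fin m → E) × (Fin m → E)) × Y => (z.1.2, z.2)) (by fun_prop)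
  have hUT : ∀ z, ∀ x ∈ T, |∑ j, (F (z.1 j) x - F (z.2 j) x)| ≤ U z := fun z x hx =>
    le_supAbs hT (continuous_finsetSum _ fun j _ => (hFx _).sub (hFx _)) hx
  have hUb : ∀ X X' : Fin m → E, (∀ j, ∀ x ∈ T, |F (X j) x| ≤ C) →
      (∀ j, ∀ x ∈ T, |F (X' j) x| ≤ C) → U (X, X') ≤ m * (2 * C) := by
    intro X X' h h'
    refine supAbs_le (by positivity) fun x hx => ?_
    refine (Finset.abs_sum_le_sum_abs _ _).trans ?_
    refine (Finset.sum_le_sum fun j _ => (abs_sub _ _).trans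
      (add_le_add (h j x hx) (h' j x hx))).trans_eq ?_
    simp; ring
  have hUint : ∀ k : ℕ, Integrable (fun z => U z ^ k) (ν.prod ν) := by
    intro k
    have h1 : ∀ᵐ z ∂ν.prod ν, ∀ j, ∀ x ∈ T, |F (z.1 j) x| ≤ C :=
      Measure.quasiMeasurePreserving_fst.ae hbν
    have h2 : ∀ᵐ z ∂ν.prod ν, ∀ j, ∀ x ∈ T, |F (z.2 j) x| ≤ C :=
      Measure.quasiMeasurePreserving_snd.ae hbν
    refine Integrable.of_bound (hUc.pow k).aestronglyMeasurable ((m * (2 * C)) ^ k) ?_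
    filter_upwards [h1, h2] with z hz1 hz2
    rw [Real.norm_of_nonneg (pow_nonneg (hU0 z) k)]
    exact pow_le_pow_left₀ (hU0 z) (hUb _ _ hz1 hz2) k
  have hUsec : ∀ X, (∀ j, ∀ x ∈ T, |F (X j) x| ≤ C) → ∀ k : ℕ,
      Integrable (fun X' => U (X, X') ^ k) ν := by
    intro X hX k
    refine Integrable.of_bound
      ((hUc.comp (Continuous.prodMk_right X)).pow k).aestronglyMeasurable ((m * (2 * C)) ^ k) ?_
    filter_upwards [hbν] with X' hX'
    rw [Real.norm_of_nonneg (pow_nonneg (hU0 _) k)]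
    exact pow_le_pow_left₀ (hU0 _) (hUb _ _ hX hX') k
  -- Since a is the mean of the independent copy, the centred sum is an average over X' of
  -- differences; the supremum and then t^p pass inside by Jensen.
  have hJ : ∀ᵐ X ∂ν, supAbs T (fun x => ∑ j, (F (X j) x - a)) ^ p ≤
      ∫ X', U (X, X') ^ p ∂ν := by
    filter_upwards [hbν] with X hX
    have hUi : Integrable (fun X' => U (X, X')) ν := by simpa using hUsec X hX 1
    have h1 : supAbs T (fun x => ∑ j, (F (X j) x - a)) ≤ ∫ X', U (X, X') ∂ν := by
      refine supAbs_le (integral_nonneg fun X' => hU0 _) fun x hx => ?_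
      have hi : ∀ j, Integrable (fun v => F v x) (μ j) := fun j => by
        refine Integrable.of_bound (hFv x).aestronglyMeasurable C ?_
        filter_upwards [hb j] with v hv using hv x hx
      have hi' : ∀ j, Integrable (fun X' : Fin m → E => F (X' j) x) ν := fun j =>
        (measurePreserving_eval μ j).integrable_comp_of_integrable (hi j)
      have e1 : ∀ j, ∫ X' : Fin m → E, F (X' j) x ∂ν = a := fun j => by
        rw [← ha j x hx, ← (measurePreserving_eval μ j).map_eq, integral_map
          (measurable_pi_apply j).aemeasurable (hFv x).aestronglyMeasurable]
      have e2 : ∑ j, (F (X j) x - a) = ∫ X' : Fin m → E, ∑ j, (F (X j) x - F (X' j) x) ∂ν := by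
        rw [integral_finsetSum _ fun j _ =>
          (integrable_const (F (X j) x)).sub' (hi' j)]
        refine Finset.sum_congr rfl fun j _ => ?_
        rw [integral_sub (integrable_const _) (hi' j), e1 j]
        simp
      rw [e2]
      refine (abs_integral_le_integral_abs).trans (integral_mono_of_nonneg
        (Filter.Eventually.of_forall fun X' => abs_nonneg _) hUi
        (Filter.Eventually.of_forall fun X' => hUT (X, X') x hx))
    refine (pow_le_pow_left₀ (supAbs_nonneg _ _) h1 p).trans ?_
    exact (convexOn_pow p).map_integral_le (s := Set.Ici (0 : ℝ)) (continuous_pow p).continuousOn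
      isClosed_Ici (Filter.Eventually.of_forall fun X' => hU0 _) hUi (hUsec X hX p)
  have h2 : ∫ X, supAbs T (fun x => ∑ j, (F (X j) x - a)) ^ p ∂ν ≤ ∫ z, U z ^ p ∂ν.prod ν := by
    rw [integral_prod _ (hUint p)]
    exact integral_mono_of_nonneg (Filter.Eventually.of_forall fun X =>
      pow_nonneg (supAbs_nonneg _ _) _) (hUint p).integral_prod_left hJ
  let S : (Fin m → E) → ℝ := fun X => supAbs T (fun x => ∑ j, sgn (e j) * F (X j) x)
  have hS0 : ∀ X, 0 ≤ S X := fun X => supAbs_nonneg _ _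
  have hSc : Continuous S :=
    continuous_supAbs hT (continuous_finsetSum _ fun j _ => continuous_const.mul (hFj j))
  have hSint : Integrable (fun X => S X ^ p) ν := by
    refine Integrable.of_bound (hSc.pow p).aestronglyMeasurable ((m * C) ^ p) ?_
    filter_upwards [hbν] with X hX
    rw [Real.norm_of_nonneg (pow_nonneg (hS0 X) p)]
    refine pow_le_pow_left₀ (hS0 X) (supAbs_le (by positivity) fun x hx => ?_) p
    refine (abs_sum_sgn_mul_le e _).trans ((Finset.sum_le_sum fun j _ => hX j x hx).trans_eq ?_)
    simp
  -- Swapping where `e` is false flips the sign of that difference, so any fixed sign pattern can be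
  -- inserted. Averaging over patterns is left to the application.
  have hUS : ∀ z, U (swapBy e z) ≤ S z.1 + S z.2 := by
    intro z
    refine supAbs_le (add_nonneg (hS0 _) (hS0 _)) fun x hx => ?_
    have e3 : ∑ j, (F ((swapBy e z).1 j) x - F ((swapBy e z).2 j) x) =
        ∑ j, sgn (e j) * F (z.1 j) x - ∑ j, sgn (e j) * F (z.2 j) x := by
      rw [← Finset.sum_sub_distrib]
      refine Finset.sum_congr rfl fun j _ => ?_
      cases h : e j <;> simp [swapBy, sgn, h]
      ring
    rw [e3]
    refine (abs_sub _ _).trans (add_le_add ?_ ?_)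
    · exact le_supAbs hT (h := fun x => ∑ j, sgn (e j) * F (z.1 j) x)
        (continuous_finsetSum _ fun j _ => continuous_const.mul (hFx _)) hx
    · exact le_supAbs hT (h := fun x => ∑ j, sgn (e j) * F (z.2 j) x)
        (continuous_finsetSum _ fun j _ => continuous_const.mul (hFx _)) hx
  have hmp := measurePreserving_swapBy μ e
  have h3 : ∫ z, U z ^ p ∂ν.prod ν = ∫ z, U (swapBy e z) ^ p ∂ν.prod ν := by
    conv_lhs => rw [← hmp.map_eq]
    rw [integral_map (f := fun z => U z ^ p) hmp.measurable.aemeasurable (hUc.pow p).aestronglyMeasurable]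
  have hS1 : Integrable (fun z : (Fin m → E) × (Fin m → E) => S z.1 ^ p) (ν.prod ν) :=
    hSint.comp_fst ν
  have hS2 : Integrable (fun z : (Fin m → E) × (Fin m → E) => S z.2 ^ p) (ν.prod ν) :=
    hSint.comp_snd ν
  have h4 : ∫ z, U (swapBy e z) ^ p ∂ν.prod ν ≤
      ∫ z, 2 ^ (p - 1) * (S z.1 ^ p + S z.2 ^ p) ∂ν.prod ν := by
    refine integral_mono_of_nonneg (Filter.Eventually.of_forall fun z => pow_nonneg (hU0 _) _)
      ((hS1.add hS2).const_mul _) (Filter.Eventually.of_forall fun z => ?_)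
    exact (pow_le_pow_left₀ (hU0 _) (hUS z) p).trans (add_pow_le (hS0 _) (hS0 _) p)
  refine h2.trans (h3.le.trans (h4.trans_eq ?_))
  rw [integral_const_mul, integral_add hS1 hS2, integral_fun_fst (fun X => S X ^ p),
    integral_fun_snd (fun X => S X ^ p)]
  obtain ⟨p, rfl⟩ := Nat.exists_eq_add_of_le' hp
  simp
  ring

end Symmetrization

/-! ### From the deviation to the isometry inequalities -/

section Deterministic

variable {m N : ℕ}

/-- The `ℓ²`-unit vectors of `ℓ¹`-norm at most `ρ`. -/
def lowEntropySphere (N : ℕ) (ρ : ℝ) : Set (Fin N → ℂ) :=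
  {x | ∑ k, ‖x k‖ ^ 2 = 1 ∧ ∑ k, ‖x k‖ ≤ ρ}

lemma isCompact_lowEntropySphere (N : ℕ) (ρ : ℝ) : IsCompact (lowEntropySphere N ρ) := by
  refine Metric.isCompact_of_isClosed_isBounded ?_ ?_
  · have h1 : IsClosed {x : Fin N → ℂ | ∑ k, ‖x k‖ ^ 2 = 1} :=
      isClosed_eq (by fun_prop) continuous_const
    have h2 : IsClosed {x : Fin N → ℂ | ∑ k, ‖x k‖ ≤ ρ} :=
      isClosed_le (by fun_prop) continuous_const
    exact h1.inter h2
  · refine (Metric.isBounded_closedBall (x := (0 : Fin N → ℂ)) (r := 1)).subset fun x hx => ?_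
    rw [mem_closedBall_zero_iff, pi_norm_le_iff_of_nonneg zero_le_one]
    intro k
    have h1 : ‖x k‖ ^ 2 ≤ ∑ k, ‖x k‖ ^ 2 :=
      Finset.single_le_sum (f := fun k => ‖x k‖ ^ 2) (fun k _ => sq_nonneg _) (Finset.mem_univ k)
    rw [hx.1] at h1
    nlinarith [norm_nonneg (x k)]

lemma lowEntropySphere_nonempty (hN : 0 < N) {ρ : ℝ} (hρ : 1 ≤ ρ) :
    (lowEntropySphere N ρ).Nonempty := by
  refine ⟨Pi.single ⟨0, hN⟩ 1, ?_, ?_⟩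
  · rw [Finset.sum_eq_single ⟨0, hN⟩] <;> simp +contextual
  · rw [Finset.sum_eq_single ⟨0, hN⟩] <;> simp +contextual [hρ]

/-- The energy `|⟨v, x⟩|²` of a sample `v` at `x`. -/
def energy (v x : Fin N → ℂ) : ℝ := ‖∑ k, v k * x k‖ ^ 2

lemma energy_row (A : Matrix (Fin m) (Fin N) ℂ) (x : Fin N → ℂ) (j : Fin m) :
    energy (A j) x = ‖A.mulVec x j‖ ^ 2 := rfl

lemma continuous_energy : Continuous fun z : (Fin N → ℂ) × (Fin N → ℂ) => energy z.1 z.2 := by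
  unfold energy; fun_prop

/-- The largest deviation of the empirical energy from `1` on the low entropy sphere. -/
def deviation (ρ : ℝ) (X : Fin m → Fin N → ℂ) : ℝ :=
  supAbs (lowEntropySphere N ρ) (fun x => ∑ j, (energy (X j) x - 1)) / m

lemma deviation_nonneg (ρ : ℝ) (X : Fin m → Fin N → ℂ) : 0 ≤ deviation ρ X :=
  div_nonneg (supAbs_nonneg _ _) (Nat.cast_nonneg m)

lemma continuous_deviation (ρ : ℝ) :
    Continuous fun X : Fin m → Fin N → ℂ => deviation ρ X := by
  refine Continuous.div_const (continuous_supAbs (isCompact_lowEntropySphere N ρ)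
    (continuous_finsetSum _ fun j _ => Continuous.sub ?_ continuous_const)) _
  exact continuous_energy.comp
    (f := fun z : (Fin m → Fin N → ℂ) × (Fin N → ℂ) => (z.1 j, z.2)) (by fun_prop)

lemma abs_sum_energy_sub_le (hm : 0 < m) {ρ : ℝ} (X : Fin m → Fin N → ℂ) {x : Fin N → ℂ}
    (hx : x ∈ lowEntropySphere N ρ) :
    |∑ j, (energy (X j) x - 1)| ≤ m * deviation ρ X := by
  have hm' : (0 : ℝ) < m := by exact_mod_cast hm
  rw [deviation, mul_div_cancel₀ _ hm'.ne']
  refine le_supAbs (isCompact_lowEntropySphere N ρ) (h := fun x => ∑ j, (energy (X j) x - 1))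
    (continuous_finsetSum _ fun j _ => Continuous.sub ?_ continuous_const) hx
  exact continuous_energy.comp (f := fun x : Fin N → ℂ => (X j, x)) (by fun_prop)

lemma l2Norm_normalized_sq (hm : 0 < m) (A : Matrix (Fin m) (Fin N) ℂ) (x : Fin N → ℂ) :
    l2Norm ((normalized A).mulVec x) ^ 2 = (∑ j, energy (A j) x) / m := by
  have hm' : (0 : ℝ) < m := by exact_mod_cast hm
  rw [l2Norm_sq, Finset.sum_div]
  refine Finset.sum_congr rfl fun j _ => ?_
  rw [normalized, Matrix.smul_mulVec, Pi.smul_apply, norm_smul, mul_pow, energy_row,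
    Real.norm_of_nonneg (by positivity), div_pow, Real.sq_sqrt hm'.le]
  ring

lemma energy_smul (v x : Fin N → ℂ) (r : ℝ) : energy v (r • x) = r ^ 2 * energy v x := by
  have : ∑ k, v k * (r • x) k = (r : ℂ) * ∑ k, v k * x k := by
    rw [Finset.mul_sum]
    refine Finset.sum_congr rfl fun k _ => ?_
    simp only [Pi.smul_apply, Complex.real_smul]; ring
  rw [energy, this, norm_mul, mul_pow, Complex.norm_real, Real.norm_eq_abs, sq_abs, energy]

/-- Both sides are homogeneous of degree 2, and a vector of entropy at most s normalises to a unit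
vector of ℓ¹-norm at most √s. -/
lemma hasLEIP_of_deviation_le (hm : 0 < m) {s δ : ℝ} (A : Matrix (Fin m) (Fin N) ℂ)
    (h : deviation √s (fun j => A j) ≤ δ) : HasLEIP (normalized A) s δ := by
  intro x hx hent
  have hm' : (0 : ℝ) < m := by exact_mod_cast hm
  have hr2 : 0 < l2Norm x ^ 2 := by
    rw [l2Norm_sq]
    obtain ⟨k, hk⟩ := Function.ne_iff.1 hx
    exact Finset.sum_pos' (fun k _ => sq_nonneg _)
      ⟨k, Finset.mem_univ k, pow_pos (norm_pos_iff.2 hk) 2⟩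
  have hr : 0 < l2Norm x := lt_of_le_of_ne (norm_nonneg _) (by rintro h0; simp [← h0] at hr2)
  set r := l2Norm x with hrdef
  have hx' : r⁻¹ • x ∈ lowEntropySphere N √s := by
    constructor
    · simp only [Pi.smul_apply, norm_smul, mul_pow, ← Finset.mul_sum]
      rw [← l2Norm_sq, ← hrdef, norm_inv, Real.norm_of_nonneg hr.le, ← mul_pow,
        inv_mul_cancel₀ hr.ne', one_pow]
    · simp only [Pi.smul_apply, norm_smul, ← Finset.mul_sum]
      rw [← l1Norm_eq_sum, norm_inv, Real.norm_of_nonneg hr.le]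
      apply Real.le_sqrt_of_sq_le
      rw [mul_pow, inv_pow, inv_mul_eq_div]
      exact hent
  have h1 := (abs_sum_energy_sub_le hm (fun j => A j) hx').trans
    (mul_le_mul_of_nonneg_left h hm'.le)
  have e : l2Norm ((normalized A).mulVec x) ^ 2 - r ^ 2 =
      r ^ 2 / m * ∑ j, (energy (A j) (r⁻¹ • x) - 1) := by
    rw [l2Norm_normalized_sq hm]
    simp only [energy_smul, Finset.sum_sub_distrib, ← Finset.mul_sum, Finset.sum_const,
      Finset.card_univ, Fintype.card_fin, nsmul_eq_mul, mul_one]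
    field_simp
  rw [e, abs_mul, abs_of_nonneg (by positivity : 0 ≤ r ^ 2 / m)]
  calc r ^ 2 / m * |∑ j, (energy (A j) (r⁻¹ • x) - 1)| ≤ r ^ 2 / m * (m * δ) := by gcongr
    _ = δ * r ^ 2 := by field_simp

lemma l1Norm_sq_le (x : Fin N → ℂ) : l1Norm x ^ 2 ≤ hammingNorm x * l2Norm x ^ 2 := by
  rw [l1Norm_eq_sum, l2Norm_sq, hammingNorm]
  have e1 : ∑ k, ‖x k‖ = ∑ k with x k ≠ 0, ‖x k‖ := by
    rw [Finset.sum_filter_of_ne]; intro k _ h; simpa using h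
  have e2 : ∑ k, ‖x k‖ ^ 2 = ∑ k with x k ≠ 0, ‖x k‖ ^ 2 := by
    rw [Finset.sum_filter_of_ne]; intro k _ h; simpa using h
  rw [e1, e2]
  exact sq_sum_le_card_mul_sum_sq

/-- Cauchy–Schwarz on the support bounds entropy by the number of nonzero entries; x = 0 is checked
apart. -/
lemma HasLEIP.hasRIP {A : Matrix (Fin m) (Fin N) ℂ} {s δ : ℝ} (h : HasLEIP A s δ) :
    HasRIP A s δ := by
  intro x hx
  rcases eq_or_ne x 0 with rfl | h0
  · simp [l2Norm]
  · have hent : entropy x ≤ s := by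
      refine div_le_of_le_mul₀ (sq_nonneg _) ((Nat.cast_nonneg _).trans hx) ?_
      exact (l1Norm_sq_le x).trans (mul_le_mul_of_nonneg_right hx (sq_nonneg _))
    have := abs_le.1 (h x h0 hent)
    constructor <;> linarith [this.1, this.2]

/-- Boundedness below need not be checked: otherwise `sInf` takes the default value 0 ≤ δ. -/
lemma sInf_le_of_mem_of_nonneg {S : Set ℝ} {δ : ℝ} (hδ : 0 ≤ δ) (h : δ ∈ S) : sInf S ≤ δ := by
  by_cases hS : BddBelow S
  · exact csInf_le hS h
  · rw [Real.sInf_of_not_bddBelow hS]; exact hδ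

end Deterministic

/-! ### Linearization of the square root; isotropy -/

section Moments

/-- The tangent to √(1 + z) at z = η is √(1 + η)/η times a convex combination of η and z; convexity
of t^p finishes. -/
lemma pow_mul_sqrt_le {D η z : ℝ} (hD : 0 ≤ D) (hη : 0 < η) (hz : 0 ≤ z) (p : ℕ) :
    (D * √(1 + z)) ^ p ≤ (D * √(1 + η) / η) ^ p *
      ((1 - η / (2 * (1 + η))) * η ^ p + η / (2 * (1 + η)) * z ^ p) := by
  set α := η / (2 * (1 + η)) with hα
  have hα0 : 0 ≤ α := by positivity
  have hα1 : α ≤ 1 := by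
    rw [hα, div_le_one (by positivity)]; linarith
  set κ := √(1 + η) with hκ
  have hκ0 : 0 < κ := Real.sqrt_pos.2 (by linarith)
  have hκ2 : κ ^ 2 = 1 + η := Real.sq_sqrt (by linarith)
  have h1 : √(1 + z) ≤ (2 + η + z) / (2 * κ) := by
    rw [le_div_iff₀ (by positivity)]
    have h2 := Real.sq_sqrt (by linarith : 0 ≤ 1 + z)
    nlinarith [sq_nonneg (√(1 + z) - κ)]
  have e1 : D * ((2 + η + z) / (2 * κ)) = D * κ / η * ((1 - α) * η + α * z) := by
    have : (1 - α) * η + α * z = η * (2 + η + z) / (2 * κ ^ 2) := by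
      rw [hα, hκ2]; field_simp; ring
    rw [this]; field_simp
  have hJ := Real.pow_arith_mean_le_arith_mean_pow (Finset.univ : Finset (Fin 2))
    ![1 - α, α] ![η, z] (by intro i _; fin_cases i <;> simp <;> linarith) (by simp)
    (by intro i _; fin_cases i <;> simp <;> linarith) p
  simp only [Fin.sum_univ_two, Matrix.cons_val_zero, Matrix.cons_val_one] at hJ
  calc (D * √(1 + z)) ^ p ≤ (D * ((2 + η + z) / (2 * κ))) ^ p := by gcongr
    _ = (D * κ / η) ^ p * ((1 - α) * η + α * z) ^ p := by rw [e1, mul_pow]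
    _ ≤ _ := by gcongr

lemma integral_energy_eq_one {Ω : Type*} [MeasurableSpace Ω] {P : Measure Ω}
    [IsProbabilityMeasure P] {m N : ℕ} {A : Ω → Matrix (Fin m) (Fin N) ℂ} {K : ℝ}
    (hA : IsRandomSamplingMatrix P A K) (j : Fin m) {x : Fin N → ℂ} (hx : ∑ k, ‖x k‖ ^ 2 = 1) :
    ∫ ω, energy (A ω j) x ∂P = 1 := by
  have hmeas : ∀ k, Measurable fun ω => A ω j k := fun k =>
    (measurable_pi_apply k).comp (hA.measurable_row j)
  have hint : ∀ k l, Integrable (fun ω => star (A ω j k) * A ω j l) P := by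
    intro k l
    have hstar : Measurable fun ω => star (A ω j k) := continuous_star.measurable.comp (hmeas k)
    refine Integrable.of_bound (hstar.mul (hmeas l)).aestronglyMeasurable (K * K) ?_
    filter_upwards [hA.bounded j] with ω hω
    rw [norm_mul, norm_star]
    exact mul_le_mul ((norm_le_pi_norm (A ω j) k).trans hω) ((norm_le_pi_norm (A ω j) l).trans hω)
      (norm_nonneg _) ((norm_nonneg _).trans hω)
  have e1 : ∀ ω, ((energy (A ω j) x : ℝ) : ℂ) =
      ∑ k, ∑ l, star (A ω j k) * A ω j l * (star (x k) * x l) := by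
    intro ω
    rw [energy]
    push_cast
    rw [← Complex.conj_mul', map_sum, Finset.sum_mul_sum]
    refine Finset.sum_congr rfl fun k _ => Finset.sum_congr rfl fun l _ => ?_
    rw [map_mul]
    simp only [← starRingEnd_apply]
    ring
  have e2 : ((∫ ω, energy (A ω j) x ∂P : ℝ) : ℂ) = 1 := by
    rw [← integral_complex_ofReal]
    simp_rw [e1]
    rw [integral_finsetSum _ fun k _ => integrable_finsetSum _ fun l _ => (hint k l).mul_const _]
    simp_rw [integral_finsetSum Finset.univ fun l _ => (hint _ l).mul_const _, integral_mul_const,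
      hA.isotropic, Matrix.one_apply, ite_mul, one_mul, zero_mul]
    simp only [Finset.sum_ite_eq, Finset.mem_univ, if_true]
    have : ∀ k, star (x k) * x k = ((‖x k‖ ^ 2 : ℝ) : ℂ) := fun k => by
      rw [← starRingEnd_apply, Complex.conj_mul']; push_cast; rfl
    simp_rw [this]
    exact_mod_cast hx
  exact_mod_cast e2

end Moments

/-! ### The self-bounding moment inequality -/

section MomentBound

variable {m N : ℕ}

lemma energy_le {v x : Fin N → ℂ} {K ρ : ℝ} (hv : ‖v‖ ≤ K) (hx : x ∈ lowEntropySphere N ρ) :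
    |energy v x| ≤ (K * ρ) ^ 2 := by
  have hK : 0 ≤ K := (norm_nonneg _).trans hv
  rw [energy, abs_of_nonneg (sq_nonneg _)]
  refine pow_le_pow_left₀ (norm_nonneg _) ((norm_sum_le _ _).trans ?_) 2
  calc ∑ k, ‖v k * x k‖ ≤ ∑ k, K * ‖x k‖ := by
        refine Finset.sum_le_sum fun k _ => ?_
        rw [norm_mul]
        exact mul_le_mul_of_nonneg_right ((norm_le_pi_norm v k).trans hv) (norm_nonneg _)
    _ ≤ K * ρ := by
        rw [← Finset.mul_sum]
        exact mul_le_mul_of_nonneg_left hx.2 hK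

/-- The self-bounding inequality for the `p`-th moment of the deviation. -/
lemma integral_deviation_pow_le (hm : 0 < m) (hN : 2 ≤ N)
    (μ : Fin m → Measure (Fin N → ℂ)) [∀ j, IsProbabilityMeasure (μ j)] {K ρ : ℝ} (hK : 0 < K)
    (hρ : 1 ≤ ρ) (hb : ∀ j, ∀ᵐ v ∂μ j, ‖v‖ ≤ K)
    (hE : ∀ j, ∀ x ∈ lowEntropySphere N ρ, ∫ v, energy v x ∂μ j = 1) {p : ℕ} (hp : 1 ≤ p)
    {q : ℝ} (hq : 1 ≤ q) (L : ℕ) :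
    Integrable (fun X => deviation ρ X ^ p) (Measure.pi μ) ∧
    Integrable (fun X => (2 * (chainSum N p L q (K * ρ) / √m + K * ρ / 2 * Real.exp (-L)) *
        √(1 + deviation ρ X)) ^ p) (Measure.pi μ) ∧
    ∫ X, deviation ρ X ^ p ∂Measure.pi μ ≤
      ∫ X, (2 * (chainSum N p L q (K * ρ) / √m + K * ρ / 2 * Real.exp (-L)) *
        √(1 + deviation ρ X)) ^ p ∂Measure.pi μ := by
  have hm' : (0 : ℝ) < m := by exact_mod_cast hm
  have hρ0 : 0 < ρ := by linarith
  set ν := Measure.pi μ with hν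
  set T := lowEntropySphere N ρ with hTdef
  have hT : IsCompact T := isCompact_lowEntropySphere N ρ
  obtain ⟨x₀, hx₀⟩ : T.Nonempty := lowEntropySphere_nonempty (by omega) hρ
  set β := chainSum N p L q (K * ρ) / √m + K * ρ / 2 * Real.exp (-L) with hβ
  have hbν : ∀ᵐ X ∂ν, ∀ j, ‖X j‖ ≤ K := by
    rw [ae_all_iff]
    intro j
    exact (measurePreserving_eval μ j).quasiMeasurePreserving.ae (hb j)
  have hbe : ∀ j, ∀ᵐ v ∂μ j, ∀ x ∈ T, |energy v x| ≤ (K * ρ) ^ 2 := fun j => by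
    filter_upwards [hb j] with v hv x hx using energy_le hv hx
  have hdc := continuous_deviation (m := m) (N := N) ρ
  have hdb : ∀ᵐ X ∂ν, deviation ρ X ≤ (K * ρ) ^ 2 + 1 := by
    filter_upwards [hbν] with X hX
    rw [deviation, div_le_iff₀ hm']
    refine supAbs_le (by positivity) fun x hx => ?_
    refine (Finset.abs_sum_le_sum_abs _ _).trans ?_
    refine (Finset.sum_le_sum fun j _ => (abs_sub _ _).trans
      (add_le_add (energy_le (hX j) hx) (abs_one (α := ℝ)).le)).trans_eq ?_
    simp; ring
  have hint1 : Integrable (fun X => deviation ρ X ^ p) ν := by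
    refine Integrable.of_bound (hdc.pow p).aestronglyMeasurable (((K * ρ) ^ 2 + 1) ^ p) ?_
    filter_upwards [hdb] with X hX
    rw [Real.norm_of_nonneg (pow_nonneg (deviation_nonneg _ _) p)]
    exact pow_le_pow_left₀ (deviation_nonneg _ _) hX p
  have hint2 : Integrable (fun X => (2 * β * √(1 + deviation ρ X)) ^ p) ν := by
    refine Integrable.of_bound (by
      refine Continuous.aestronglyMeasurable ?_
      fun_prop) ((|2 * β| * √(1 + ((K * ρ) ^ 2 + 1))) ^ p) ?_
    filter_upwards [hdb] with X hX
    rw [norm_pow, norm_mul, Real.norm_eq_abs, Real.norm_of_nonneg (Real.sqrt_nonneg _)]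
    gcongr
  refine ⟨hint1, hint2, ?_⟩
  have hw : ∀ e : Fin m → Bool, 0 ≤ ∏ _j : Fin m, (1 / 2 : ℝ) := fun _ => by positivity
  have hw1 : ∑ e : Fin m → Bool, ∏ _j : Fin m, (1 / 2 : ℝ) = 1 :=
    sum_prod_weight (κ := Fin m) (w := fun _ : Bool => (1 / 2 : ℝ)) (by simp)
  let S : (Fin m → Bool) → (Fin m → Fin N → ℂ) → ℝ := fun e X =>
    supAbs T (fun x => ∑ j, sgn (e j) * energy (X j) x)
  have hSc : ∀ e, Continuous (S e) := fun e =>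
    continuous_supAbs hT (continuous_finsetSum _ fun j _ => continuous_const.mul
      (continuous_energy.comp
        (f := fun z : (Fin m → Fin N → ℂ) × (Fin N → ℂ) => (z.1 j, z.2)) (by fun_prop)))
  have hSint : ∀ e, Integrable (fun X => S e X ^ p) ν := by
    intro e
    refine Integrable.of_bound ((hSc e).pow p).aestronglyMeasurable ((m * (K * ρ) ^ 2) ^ p) ?_
    filter_upwards [hbν] with X hX
    rw [Real.norm_of_nonneg (pow_nonneg (supAbs_nonneg _ _) p)]
    refine pow_le_pow_left₀ (supAbs_nonneg _ _) (supAbs_le (by positivity) fun x hx => ?_) p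
    refine (abs_sum_sgn_mul_le e _).trans
      ((Finset.sum_le_sum fun j _ => energy_le (hX j) hx).trans_eq ?_)
    simp
  have hsym : ∀ e, ∫ X, (m * deviation ρ X) ^ p ∂ν ≤ 2 ^ p * ∫ X, S e X ^ p ∂ν := by
    intro e
    have h1 := integral_supAbs_pow_le_two_pow_mul μ hT continuous_energy (sq_nonneg (K * ρ)) hbe
      hE hp e
    have h2 : ∀ X : Fin m → Fin N → ℂ,
        supAbs T (fun x => ∑ j, (energy (X j) x - 1)) = m * deviation ρ X := fun X => by
      rw [deviation, mul_div_cancel₀ _ hm'.ne']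
    simp_rw [h2] at h1
    exact h1
  have hcond : ∀ᵐ X ∂ν, ∑ e : Fin m → Bool, (∏ _j : Fin m, (1 / 2 : ℝ)) * S e X ^ p ≤
      (m * (β * √(1 + deviation ρ X))) ^ p := by
    filter_upwards [hbν] with X hX
    -- The energy level W for the chaining is the random 1 + Z itself; this is what makes the final
    -- inequality self-bounding.
    have hW : 1 ≤ 1 + deviation ρ X := by linarith [deviation_nonneg ρ X]
    obtain ⟨G, hG1, hG2⟩ := exists_rademacher_bound hm hN (fun j => X j) hK hρ0 hX
      (T := T) (fun x hx => by rw [l1Norm_eq_sum]; exact hx.2) hW (fun x hx => by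
        have h1 := (abs_le.1 (abs_sum_energy_sub_le hm X hx)).2
        rw [Finset.sum_sub_distrib] at h1
        simp only [Finset.sum_const, Finset.card_univ, Fintype.card_fin, nsmul_eq_mul,
          mul_one] at h1
        have h2 : ∑ j, ‖Matrix.mulVec (fun j => X j) x j‖ ^ 2 = ∑ j, energy (X j) x := rfl
        rw [h2]; linarith) hp hq L
    refine le_trans (Finset.sum_le_sum fun e _ => ?_) (hG2.trans_eq ?_)
    · refine mul_le_mul_of_nonneg_left (pow_le_pow_left₀ (supAbs_nonneg _ _) ?_ p) (hw e)
      exact supAbs_le ((abs_nonneg _).trans (hG1 e x₀ hx₀)) fun x hx => hG1 e x hx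
    · congr 1
      rw [Real.sqrt_mul hm'.le, hβ]
      have : (m : ℝ) = √m * √m := (Real.mul_self_sqrt hm'.le).symm
      have h0 : √(m : ℝ) ≠ 0 := (Real.sqrt_pos.2 hm').ne'
      field_simp
      linear_combination (-(2 * chainSum N p L q (K * ρ))) * this
  have hmain : ∫ X, (m * deviation ρ X) ^ p ∂ν ≤
      2 ^ p * ∫ X, (m * (β * √(1 + deviation ρ X))) ^ p ∂ν := by
    -- `hsym` holds for every sign pattern, so it may be averaged; exchanging sum and integral then
    -- allows the bound `hcond` for fixed rows.
    calc ∫ X, (m * deviation ρ X) ^ p ∂ν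
        = ∑ e : Fin m → Bool, (∏ _j : Fin m, (1 / 2 : ℝ)) * ∫ X, (m * deviation ρ X) ^ p ∂ν := by
          rw [← Finset.sum_mul, hw1, one_mul]
      _ ≤ ∑ e : Fin m → Bool, (∏ _j : Fin m, (1 / 2 : ℝ)) * (2 ^ p * ∫ X, S e X ^ p ∂ν) :=
          Finset.sum_le_sum fun e _ => mul_le_mul_of_nonneg_left (hsym e) (hw e)
      _ = 2 ^ p * ∫ X, ∑ e : Fin m → Bool, (∏ _j : Fin m, (1 / 2 : ℝ)) * S e X ^ p ∂ν := by
          rw [integral_finsetSum _ fun e _ => (hSint e).const_mul _, Finset.mul_sum]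
          refine Finset.sum_congr rfl fun e _ => ?_
          rw [integral_const_mul]; ring
      _ ≤ _ := by
          refine mul_le_mul_of_nonneg_left ?_ (by positivity)
          refine integral_mono_of_nonneg (Filter.Eventually.of_forall fun X =>
            Finset.sum_nonneg fun e _ => mul_nonneg (hw e) (pow_nonneg (supAbs_nonneg _ _) _))
            ?_ hcond
          have := hint2.const_mul ((m / 2 : ℝ) ^ p)
          refine this.congr (Filter.Eventually.of_forall fun X => ?_)
          simp only [← mul_pow]
          congr 1; ring
  have hmp : (0 : ℝ) < m ^ p := by positivity
  refine le_of_mul_le_mul_left ?_ hmp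
  calc (m : ℝ) ^ p * ∫ X, deviation ρ X ^ p ∂ν = ∫ X, (m * deviation ρ X) ^ p ∂ν := by
        rw [← integral_const_mul]; simp_rw [mul_pow]
    _ ≤ 2 ^ p * ∫ X, (m * (β * √(1 + deviation ρ X))) ^ p ∂ν := hmain
    _ = _ := by
        rw [← integral_const_mul, ← integral_const_mul]
        congr 1; funext X
        rw [← mul_pow, ← mul_pow]
        congr 1; ring

end MomentBound

/-! ### Tail bound and choice of parameters -/

section Tail

/-- A self-bounding moment inequality yields a tail bound. -/
lemma measureReal_lt_of_selfBounding {Ω : Type*} [MeasurableSpace Ω] {ν : Measure Ω}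
    [IsProbabilityMeasure ν] {Z : Ω → ℝ} (hZ : ∀ ω, 0 ≤ Z ω) {p : ℕ} (hp : 1 ≤ p) {D a δ : ℝ}
    (hD : 0 ≤ D) (ha : 0 < a) (hδ : 0 < δ) (hDη : D * √(1 + δ / a) < δ / a)
    (hint : Integrable (fun ω => Z ω ^ p) ν)
    (hint2 : Integrable (fun ω => (D * √(1 + Z ω)) ^ p) ν)
    (h : ∫ ω, Z ω ^ p ∂ν ≤ ∫ ω, (D * √(1 + Z ω)) ^ p ∂ν) :
    ν.real {ω | δ < Z ω} < (1 / a) ^ p := by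
  set η := δ / a with hηdef
  have hη : 0 < η := by positivity
  set α := η / (2 * (1 + η)) with hα
  have hα0 : 0 ≤ α := by positivity
  have hα1 : α ≤ 1 := by rw [hα, div_le_one (by positivity)]; linarith
  set θ := D * √(1 + η) / η with hθ
  have hθ0 : 0 ≤ θ := by positivity
  have hθ1 : θ < 1 := by rw [hθ, div_lt_one hη]; exact hDη
  have hθp : θ ^ p < 1 := pow_lt_one₀ hθ0 hθ1 (by omega)
  set I := ∫ ω, Z ω ^ p ∂ν with hI
  have h1 : I ≤ θ ^ p * ((1 - α) * η ^ p + α * I) := by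
    calc I ≤ ∫ ω, (D * √(1 + Z ω)) ^ p ∂ν := h
      _ ≤ ∫ ω, θ ^ p * ((1 - α) * η ^ p + α * Z ω ^ p) ∂ν :=
          integral_mono hint2 (((integrable_const _).add (hint.const_mul α)).const_mul _)
            fun ω => pow_mul_sqrt_le hD hη (hZ ω) p
      _ = _ := by
          rw [integral_const_mul, integral_add (integrable_const _) (hint.const_mul α),
            integral_const_mul α]
          simp [hI]
  have hηp : 0 < η ^ p := by positivity
  -- If I ≥ η^p, the convex combination in `h1` is at most I, so I ≤ θ^p I with θ^p < 1,
  -- contradicting I > 0.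
  have hlt : I < η ^ p := by
    by_contra hcon
    push Not at hcon
    have hI0 : 0 < I := hηp.trans_le hcon
    have h2 : (1 - α) * η ^ p + α * I ≤ I := by nlinarith
    have h3 : θ ^ p * ((1 - α) * η ^ p + α * I) ≤ θ ^ p * I :=
      mul_le_mul_of_nonneg_left h2 (by positivity)
    nlinarith
  have hM := mul_meas_ge_le_integral_of_nonneg
    (Filter.Eventually.of_forall fun ω => pow_nonneg (hZ ω) p) hint (δ ^ p)
  have hsub : ν.real {ω | δ < Z ω} ≤ ν.real {ω | δ ^ p ≤ Z ω ^ p} :=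
    measureReal_mono fun ω (hω : δ < Z ω) => pow_le_pow_left₀ hδ.le hω.le p
  have hδp : 0 < δ ^ p := by positivity
  have h4 : δ ^ p * ν.real {ω | δ < Z ω} < δ ^ p * (1 / a) ^ p := by
    calc δ ^ p * ν.real {ω | δ < Z ω} ≤ δ ^ p * ν.real {ω | δ ^ p ≤ Z ω ^ p} := by gcongr
      _ ≤ I := hM
      _ < η ^ p := hlt
      _ = δ ^ p * (1 / a) ^ p := by rw [hηdef, ← mul_pow, mul_one_div]
  exact lt_of_mul_lt_mul_left h4 hδp.le

/-- The choice of the moment, the exponent and the number of levels. -/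
lemma exists_chaining_parameters (m N : ℕ) (hN : 2 ≤ N) (K : ℝ) (hK : 1 ≤ K)
    (s δ ε lam : ℝ) (hs : 1 ≤ s) (hδ₀ : 0 < δ) (hδ₁ : δ < 1) (hε₀ : 0 < ε) (hε₁ : ε < 1)
    (hlam₀ : 0 < lam) (hlam₁ : lam < 1)
    (hm : C₁ δ lam * K * √s *
        (√(Real.log ((2 : ℝ) ^ (3 / 4 : ℝ) * K ^ 2 * s)) *
            Real.log (C₂ δ lam * K ^ 2 * s) * √(Real.log N) +
          √(Real.log (1 / ε))) < √(m : ℝ)) :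
    0 < m ∧ ∃ (p L : ℕ) (q : ℝ), 1 ≤ p ∧ 2 * Real.log (1 / ε) ≤ p ∧ 1 ≤ q ∧
      0 ≤ 2 * (chainSum N p L q (K * √s) / √m + K * √s / 2 * Real.exp (-L)) ∧
      2 * (chainSum N p L q (K * √s) / √m + K * √s / 2 * Real.exp (-L)) *
        √(1 + δ / √(Real.exp 1)) < δ / √(Real.exp 1) := by
  set a := √(Real.exp 1) with ha
  have ha0 : 0 < a := Real.sqrt_pos.2 (Real.exp_pos 1)
  have ha2 : a ^ 2 = Real.exp 1 := Real.sq_sqrt (Real.exp_pos 1).le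
  have ha_exp : a = Real.exp (1 / 2) := by rw [ha, Real.sqrt_eq_rpow, ← Real.exp_mul, one_mul]
  have ha1 : 1 < a := by rw [ha_exp]; exact Real.one_lt_exp_iff.2 (by norm_num)
  set b := Real.exp (1 / 4) with hb
  have hb0 : 0 < b := Real.exp_pos _
  have hb1 : 1 < b := Real.one_lt_exp_iff.2 (by norm_num)
  have hb2 : b ^ 2 = a := by rw [hb, ha_exp, ← Real.exp_nat_mul]; norm_num
  have hc0 : 0 < √(a + δ) := Real.sqrt_pos.2 (by linarith)
  have hc2 : √(a + δ) ^ 2 = a + δ := Real.sq_sqrt (by linarith)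
  -- The critical value, for which D√(1 + δ/a) = δ/a with a = √e and b = e^{1/4}. The chain will use
  -- less than (1 - λ)D and the remainder at most λD.
  set D := δ / (b * √(a + δ)) with hD
  have hD0 : 0 < D := by positivity
  have hD1 : D ≤ 1 := by
    rw [hD, div_le_one (by positivity)]
    have : 1 ≤ √(a + δ) := by rw [Real.one_le_sqrt]; linarith
    nlinarith
  have hl1 := Real.log_two_gt_d9
  have hlam' : 0 < 1 - lam := by linarith
  have hC1 : C₁ δ lam = 32 / Real.log 2 / ((1 - lam) * D) := by
    rw [C₁, ← ha, ← hb, hD]; field_simp; norm_num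
  have hC2 : C₂ δ lam = 64 * Real.exp 1 / (lam * D) ^ 2 := by
    have e3 : Real.exp (3 / 2) = a ^ 3 := by rw [ha_exp, ← Real.exp_nat_mul]; norm_num
    rw [C₂, ← ha, e3, hD, ← ha2, mul_div_assoc', div_pow, mul_pow, mul_pow b, hc2, hb2, mul_pow]
    field_simp
    ring
  have hs0 : 0 ≤ s := by linarith
  have hρ1 : 1 ≤ √s := Real.one_le_sqrt.2 hs
  set M := K * √s with hM
  have hM1 : 1 ≤ M := one_le_mul_of_one_le_of_one_le hK hρ1
  have hM0 : 0 < M := by linarith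
  have hM2 : K ^ 2 * s = M ^ 2 := by rw [hM, mul_pow, Real.sq_sqrt hs0]
  set x := Real.log (1 / ε) with hx
  have hx0 : 0 < x := Real.log_pos (by rw [one_lt_div hε₀]; exact hε₁)
  -- Depth y makes the remainder M e^{-y} equal to λD; `C₂` is such that the logarithm in the
  -- hypothesis is 2y + 1 + 6 log 2.
  set y := Real.log (M / (lam * D)) with hy
  have hlD0 : 0 < lam * D := by positivity
  have hy0 : 0 ≤ y := Real.log_nonneg (by
    rw [le_div_iff₀ hlD0, one_mul]
    exact (mul_le_one₀ hlam₁.le hD0.le hD1).trans hM1)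
  have hlog1 : Real.log ((2 : ℝ) ^ (3 / 4 : ℝ) * K ^ 2 * s) =
      Real.log (M ^ 2) + 3 / 4 * Real.log 2 := by
    rw [mul_assoc, hM2, Real.log_mul (by positivity) (by positivity),
      Real.log_rpow (by norm_num)]
    ring
  have hlog2 : Real.log (C₂ δ lam * K ^ 2 * s) = 2 * y + 1 + 6 * Real.log 2 := by
    have e1 : C₂ δ lam * K ^ 2 * s = 2 ^ 6 * Real.exp 1 * (M / (lam * D)) ^ 2 := by
      rw [mul_assoc, hM2, hC2, div_pow]; norm_num; ring
    rw [e1, Real.log_mul (by positivity) (by positivity),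
      Real.log_mul (by positivity) (by positivity), Real.log_pow, Real.log_pow, Real.log_exp, hy]
    push_cast; ring
  set p := ⌈2 * x⌉₊ with hp
  have hp1 : 1 ≤ p := Nat.one_le_ceil_iff.2 (by linarith)
  have hpx : (p : ℝ) ≤ 2 * x + 1 := (Nat.ceil_lt_add_one (by linarith)).le
  have hpx' : 2 * x ≤ p := Nat.le_ceil _
  set L := ⌈y⌉₊ with hL
  have hLy : (L : ℝ) ≤ y + 1 := (Nat.ceil_lt_add_one hy0).le
  have hLy' : y ≤ L := Nat.le_ceil _
  have hnum := two_mul_chainSum_le (L := L) hN hM1 hx0.le hy0 hpx hLy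
  rw [hlog1, hlog2, hC1] at hm
  set H := √(Real.log (M ^ 2) + 3 / 4 * Real.log 2) * (2 * y + 1 + 6 * Real.log 2) *
    √(Real.log N) + √x with hH
  have hH0 : 0 < H := by
    have : 0 < √x := Real.sqrt_pos.2 hx0
    positivity
  have hm1 : 32 / Real.log 2 * M * H < (1 - lam) * D * √m := by
    have e : 32 / Real.log 2 / ((1 - lam) * D) * K * √s * H =
        32 / Real.log 2 * M * H / ((1 - lam) * D) := by rw [hM]; ring
    rw [e, div_lt_iff₀ (by positivity)] at hm
    linarith
  -- The left side of the hypothesis is positive, which excludes m = 0.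
  have hsm : 0 < √(m : ℝ) := by
    have h1 : 0 < 32 / Real.log 2 * M * H := by positivity
    have h2 : 0 < (1 - lam) * D := by positivity
    exact pos_of_mul_pos_right (h1.trans hm1) h2.le
  have hm0 : 0 < m := by
    have := Real.sqrt_pos.1 hsm
    exact_mod_cast this
  set q := 1 + Real.log (M ^ 2) with hq
  have hq1 : 1 ≤ q := by
    have : 0 ≤ Real.log (M ^ 2) := Real.log_nonneg (one_le_pow₀ hM1)
    linarith
  set β := chainSum N p L q M / √m + M / 2 * Real.exp (-L) with hβ
  have hch0 : 0 ≤ chainSum N p L q M := by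
    rw [chainSum]
    exact add_nonneg (by positivity) (Finset.sum_nonneg fun k _ => by positivity)
  have hβ0 : 0 ≤ 2 * β := by positivity
  have hβD : 2 * β < D := by
    have h1 : 2 * chainSum N p L q M / √m < (1 - lam) * D := by
      rw [div_lt_iff₀ hsm]; linarith
    have h2 : M * Real.exp (-L) ≤ lam * D := by
      have h3 : Real.exp (-(L : ℝ)) ≤ Real.exp (-y) := Real.exp_le_exp.2 (by linarith)
      have h4 : Real.exp (-y) = lam * D / M := by
        rw [hy, Real.exp_neg, Real.exp_log (by positivity), inv_div]
      calc M * Real.exp (-L) ≤ M * (lam * D / M) := by rw [← h4]; gcongr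
        _ = lam * D := by field_simp
    have e : 2 * β = 2 * chainSum N p L q M / √m + M * Real.exp (-L) := by rw [hβ]; ring
    rw [e]; linarith
  have hDη : 2 * β * √(1 + δ / a) < δ / a := by
    have e1 : √(1 + δ / a) = √(a + δ) / b := by
      rw [show 1 + δ / a = (a + δ) / b ^ 2 by rw [hb2]; field_simp,
        Real.sqrt_div' _ (sq_nonneg b), Real.sqrt_sq hb0.le]
    have e2 : D * (√(a + δ) / b) = δ / a := by
      rw [hD, ← hb2]; field_simp
    rw [e1, ← e2]
    exact mul_lt_mul_of_pos_right hβD (by positivity)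
  exact ⟨hm0, p, L, q, hp1, hpx', hq1, hβ0, hDη⟩

/-- The tail bound for the deviation of a random sampling matrix. -/
lemma measureReal_deviation_lt {Ω : Type*} [MeasurableSpace Ω] (P : Measure Ω)
    [IsProbabilityMeasure P] (m N : ℕ) (hN : 2 ≤ N) (A : Ω → Matrix (Fin m) (Fin N) ℂ)
    (K : ℝ) (hK : 1 ≤ K) (hA : IsRandomSamplingMatrix P A K)
    (s δ ε lam : ℝ) (hs : 1 ≤ s) (hδ₀ : 0 < δ) (hδ₁ : δ < 1) (hε₀ : 0 < ε) (hε₁ : ε < 1)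
    (hlam₀ : 0 < lam) (hlam₁ : lam < 1)
    (hm : C₁ δ lam * K * √s *
        (√(Real.log ((2 : ℝ) ^ (3 / 4 : ℝ) * K ^ 2 * s)) *
            Real.log (C₂ δ lam * K ^ 2 * s) * √(Real.log N) +
          √(Real.log (1 / ε))) < √(m : ℝ)) :
    0 < m ∧ P.real {ω | δ < deviation √s (fun j => A ω j)} < ε := by
  obtain ⟨hm0, p, L, q, hp1, hpx', hq1, hβ0, hDη⟩ := exists_chaining_parameters m N hN K hK
    s δ ε lam hs hδ₀ hδ₁ hε₀ hε₁ hlam₀ hlam₁ hm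
  refine ⟨hm0, ?_⟩
  have hρ1 : 1 ≤ √s := Real.one_le_sqrt.2 hs
  have ha0 : 0 < √(Real.exp 1) := Real.sqrt_pos.2 (Real.exp_pos 1)
  have ha_exp : √(Real.exp 1) = Real.exp (1 / 2) := by
    rw [Real.sqrt_eq_rpow, ← Real.exp_mul, one_mul]
  let μ : Fin m → Measure (Fin N → ℂ) := fun j => P.map (fun ω => (A ω j : Fin N → ℂ))
  have hmeas := hA.measurable_row
  have hprob : ∀ j, IsProbabilityMeasure (μ j) := fun j =>
    Measure.isProbabilityMeasure_map (hmeas j).aemeasurable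
  -- Independence of the rows says that their joint law is a product measure.
  have hlaw : P.map (fun ω j => (A ω j : Fin N → ℂ)) = Measure.pi μ :=
    (iIndepFun_iff_map_fun_eq_pi_map fun j => (hmeas j).aemeasurable).1 hA.indep
  have hmeasA : Measurable (fun ω j => (A ω j : Fin N → ℂ)) := measurable_pi_lambda _ hmeas
  obtain ⟨hi1, hi2, hi3⟩ := integral_deviation_pow_le hm0 hN μ (by linarith : 0 < K) hρ1
    (fun j => by
      rw [ae_map_iff (hmeas j).aemeasurable
        (isClosed_le continuous_norm continuous_const).measurableSet]
      exact hA.bounded j)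
    (fun j z hz => by
      have hcz : Continuous fun v : Fin N → ℂ => energy v z :=
        continuous_energy.comp (f := fun v : Fin N → ℂ => (v, z)) (by fun_prop)
      rw [integral_map (hmeas j).aemeasurable hcz.aestronglyMeasurable]
      exact integral_energy_eq_one hA j hz.1) hp1 hq1 L
  have htail := measureReal_lt_of_selfBounding (fun X => deviation_nonneg (√s) X) hp1 hβ0 ha0 hδ₀
    hDη hi1 hi2 hi3
  have hset : MeasurableSet {X : Fin m → Fin N → ℂ | δ < deviation √s X} :=
    (isOpen_lt continuous_const (continuous_deviation _)).measurableSet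
  rw [← hlaw, map_measureReal_apply hmeasA hset] at htail
  refine htail.trans_le ?_
  have e1 : (1 / √(Real.exp 1)) ^ p = Real.exp (-(p / 2)) := by
    rw [ha_exp, one_div, ← Real.exp_neg, ← Real.exp_nat_mul]; congr 1; ring
  rw [e1]
  calc Real.exp (-(p / 2)) ≤ Real.exp (-Real.log (1 / ε)) := Real.exp_le_exp.2 (by linarith)
    _ = ε := by rw [one_div, Real.log_inv, neg_neg, Real.exp_log hε₀]

end Tail

end CompressiveSensing

end

theorem mainTheorem1 {Ω : Type*} [MeasurableSpace Ω] (P : Measure Ω) [IsProbabilityMeasure P]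
    (m N : ℕ) (hN : 2 ≤ N) (A : Ω → Matrix (Fin m) (Fin N) ℂ)
    (K : ℝ) (hK : 1 ≤ K) (hA : CompressiveSensing.IsRandomSamplingMatrix P A K)
    (s δ ε lam : ℝ) (hs : 1 ≤ s) (hδ₀ : 0 < δ) (hδ₁ : δ < 1) (hε₀ : 0 < ε) (hε₁ : ε < 1)
    (hlam₀ : 0 < lam) (hlam₁ : lam < 1)
    (hm : CompressiveSensing.C₁ δ lam * K * √s *
        (√(Real.log ((2 : ℝ) ^ (3 / 4 : ℝ) * K ^ 2 * s)) *
            Real.log (CompressiveSensing.C₂ δ lam * K ^ 2 * s) * √(Real.log N) +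
          √(Real.log (1 / ε))) < √(m : ℝ)) :
    (P.real {ω | δ < CompressiveSensing.leicConst (CompressiveSensing.normalized (A ω)) s} < ε ∧
      1 - ε < P.real {ω | CompressiveSensing.HasLEIP (CompressiveSensing.normalized (A ω)) s δ}) ∧
    (P.real {ω | δ < CompressiveSensing.ricConst (CompressiveSensing.normalized (A ω)) s} < ε ∧
      1 - ε < P.real {ω | CompressiveSensing.HasRIP (CompressiveSensing.normalized (A ω)) s δ}) := by
  obtain ⟨hm0, htail⟩ := CompressiveSensing.measureReal_deviation_lt P m N hN A K hK hA s δ ε lam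
    hs hδ₀ hδ₁ hε₀ hε₁ hlam₀ hlam₁ hm
  -- `B` is measurable because the deviation is continuous in the rows. The events of the theorem
  -- are only compared with `B` or its complement by monotonicity, so their own measurability is not
  -- needed.
  set B : Set Ω := {ω | δ < CompressiveSensing.deviation √s (fun j => A ω j)} with hB
  have hBmeas : MeasurableSet B :=
    (measurable_pi_lambda _ hA.measurable_row)
      (isOpen_lt continuous_const (CompressiveSensing.continuous_deviation _)).measurableSet
  have hLEIP : ∀ ω, ω ∉ B → CompressiveSensing.HasLEIP (CompressiveSensing.normalized (A ω)) s δ :=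
    fun ω hω => CompressiveSensing.hasLEIP_of_deviation_le hm0 (A ω) (not_lt.1 hω)
  have hcompl : 1 - ε < P.real Bᶜ := by
    rw [probReal_compl_eq_one_sub hBmeas]; linarith
  refine ⟨⟨(measureReal_mono fun ω hω => ?_).trans_lt htail,
    hcompl.trans_le (measureReal_mono fun ω hω => hLEIP ω hω)⟩,
    (measureReal_mono fun ω hω => ?_).trans_lt htail,
    hcompl.trans_le (measureReal_mono fun ω hω => (hLEIP ω hω).hasRIP)⟩
  · by_contra hcon
    exact absurd hω (not_lt.2
      (CompressiveSensing.sInf_le_of_mem_of_nonneg hδ₀.le (hLEIP ω hcon)))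
  · by_contra hcon
    exact absurd hω (not_lt.2
      (CompressiveSensing.sInf_le_of_mem_of_nonneg hδ₀.le (hLEIP ω hcon).hasRIP))
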